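/- Let $n\ge 1$ and $H>0$. Points of the expanding Poincaré patch of $n$-dimensional de Sitter spacetime have intrinsic coordinates $(t,\vec x)$, $t\in\mathbb R$, $\vec x\in\mathbb R^{n-1}$, and embedding coordinates $$X^0=\tfrac1H\sinh(Ht)+\tfrac H2 e^{Ht}\vec x^2,\qquad X^a=e^{Ht}x^a,\qquad X^n=\tfrac1H\cosh(Ht)-\tfrac H2 e^{Ht}\vec x^2 ,$$ $a=1,\dots,n-1$. Where $X^n>0$ one has $X^n=\sqrt{H^{-2}+(X^0)^2-\delta_{ab}X^aX^b}$, and $t=\frac1H\ln[H(X^0+X^n)]$, $x^a=X^a/(H(X^0+X^n))$ become functions of $X^\mu=(X^0,\dots,X^{n-1})$ alone, defined and smooth near such points; they are called the extensions of the coordinates. Let $\eta=\mathrm{diag}(-1,1,\dots,1)$ be the metric on $\mathbb R^n$, $X\cdot Y=\eta_{\mu\nu}X^\mu Y^\nu$, and, for a real skew-symmetric $n\times n$ matrix $\Theta$, $(\Theta X)^\mu=\Theta^{\mu\nu}X_\nu$. Call a smooth $f:\mathbb R^n\to\mathbb C$ admissible if there is an $m$ such that every derivative satisfies $|\partial^\alpha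 f(X)|\le C_\alpha(1+|X|)^m$. For admissible $f,g$ the deformed product is $$(f\times_\Theta g)(Z)=(2\pi)^{-n}\lim_{\epsilon\to0^+}\iint\chi(\epsilon X,\epsilon Y)\,f(Z+\Theta X)\,g(Z+Y)\,e^{iX\cdot Y}\,d^nX\,d^nY,$$ where $\chi\in\mathscr S(\mathbb R^{2n})$ is any function with $\chi(0,0)=1$, and $[f,g]_\Theta=f\times_\Theta g-g\times_\Theta f$. A representative of a coordinate at a point $z$ is an admissible function which agrees with the extension of this coordinate in a neighbourhood of the embedding point $Z$ of $z$. Let $z=(t,\vec x)$ be a point with $X^n>0$. Then $t$ and every $x^b$ have representatives at $z$. For all representatives of the coordinates at $z$ and all skew-symmetric $\Theta$, the deformed commutators at $Z$ exist and do not depend on $\chi$, and as $\Theta\to0$ $$[t,x^b]_\Theta=2i\,e^{-2Ht}\left[\Theta^{0b}-\Theta^{\rho b}F_\rho\right]+O(\Theta^2),$$ $$[x^a,x^b]_\Theta=2i\,e^{-2Ht}\left[\Theta^{ab}-Hx^a\left(\Theta^{0b}-\Theta^{\rho b}F_\rho\right)+Hx^b\left(\Theta^{0a}-\Theta^{\rho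 a}F_\rho\right)\right]+O(\Theta^2),$$ where the constant in $O(\Theta^2)$ may depend on the point and on the representatives, and $$F^\mu=\frac{X^\mu}{X^n}=\left(\cosh(Ht)-\tfrac{H^2}{2}e^{Ht}\vec x^2\right)^{-1}\begin{pmatrix}\sinh(Ht)+\frac{H^2}{2}e^{Ht}\vec x^2\\ He^{Ht}x^a\end{pmatrix}.$$ Moreover, the first-order non-commutativity decays exponentially in cosmological time: if $H|\vec x|<1$, then $X^n>0$ for all $t$, and there is a constant $K$, independent of $t$ and $\Theta$, such that the first-order terms on the right-hand sides are bounded in absolute value by $K e^{-2Ht}\max_{\mu,\nu}|\Theta^{\mu\nu}|$. -/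

import Mathlib

open Filter Topology MeasureTheory
open scoped SchwartzMap ContDiff

noncomputable section

namespace DeSitter

/-! Throughout, the de Sitter spacetime has dimension `n = d + 1`, with time index `0` and
spatial indices `a.succ`, `a : Fin d`. -/

/-- The first `n = d + 1` coordinates `X^μ = (X^0, X^a)` of the embedding space `ℝ^{1,n}`;
a function on `ℝ^{1,n}` that does not depend on `X^n` is a function on this space. -/
abbrev Emb (d : ℕ) : Type := EuclideanSpace ℝ (Fin (d + 1))

/-- `x² = δ_{ab} x^a x^b`. -/
def sqSum {d : ℕ} (x : Fin d → ℝ) : ℝ := ∑ a, x a ^ 2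

/-- The point `(X^0, X^a)` of the expanding Poincaré patch with intrinsic coordinates `(t, x)`. -/
def embPoint {d : ℕ} (H t : ℝ) (x : Fin d → ℝ) : Emb d :=
  WithLp.toLp 2 (Fin.cons
    (1 / H * Real.sinh (H * t) + H / 2 * Real.exp (H * t) * sqSum x)
    (fun a => Real.exp (H * t) * x a))

/-- The last embedding coordinate `X^n` of the point with intrinsic coordinates `(t, x)`. -/
def embLast {d : ℕ} (H t : ℝ) (x : Fin d → ℝ) : ℝ :=
  1 / H * Real.cosh (H * t) - H / 2 * Real.exp (H * t) * sqSum x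

/-- `X^n` as a shorthand for `√(H⁻² + (X^0)² - δ_{ab} X^a X^b)`. -/
def lastOf {d : ℕ} (H : ℝ) (X : Emb d) : ℝ :=
  √((H ^ 2)⁻¹ + X 0 ^ 2 - ∑ a : Fin d, X a.succ ^ 2)

/-- The inverse parametrization, time coordinate. -/
def timeOf {d : ℕ} (H : ℝ) (X : Emb d) : ℝ :=
  1 / H * Real.log (H * (X 0 + lastOf H X))

/-- The inverse parametrization, spatial coordinates. -/
def spaceOf {d : ℕ} (H : ℝ) (X : Emb d) : Fin d → ℝ :=
  fun a => X a.succ / (H * (X 0 + lastOf H X))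

/-- The extension, independent of `X^n`, of a function `φ(t, x)` to the embedding space. It has
its meaning where the root is real and `X^0 + X^n > 0`; only germs at such points are used. -/
def extension {d : ℕ} (H : ℝ) (φ : ℝ → (Fin d → ℝ) → ℂ) : Emb d → ℂ :=
  fun X => φ (timeOf H X) (spaceOf H X)

/-- The coordinate function `t`. -/
def coordT {d : ℕ} : ℝ → (Fin d → ℝ) → ℂ := fun t _ => (t : ℂ)

/-- The coordinate function `x^b`. -/
def coordX {d : ℕ} (b : Fin d) : ℝ → (Fin d → ℝ) → ℂ := fun _ x => (x b : ℂ)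

/-- Lowering an index with `η = diag(-1, 1, …, 1)`. -/
def lowerIndex {d : ℕ} (X : Emb d) : Emb d :=
  WithLp.toLp 2 (fun μ => if μ = 0 then -X μ else X μ)

/-- The Minkowski product `X · Y = -X^0 Y^0 + δ_{ab} X^a Y^b`. -/
def mink {d : ℕ} (X Y : Emb d) : ℝ := -(X 0 * Y 0) + ∑ a : Fin d, X a.succ * Y a.succ

/-- `(Θ X)^μ = Θ^{μν} X_ν`. -/
def thetaAct {d : ℕ} (Θ : Matrix (Fin (d + 1)) (Fin (d + 1)) ℝ) (X : Emb d) : Emb d :=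
  WithLp.toLp 2 (fun μ => ∑ ν, Θ μ ν * lowerIndex X ν)

/-- The regularized integral
`(2π)^{-n} ∬ χ(εX, εY) f(Z + ΘX) g(Z + Y) exp(i X·Y) dⁿX dⁿY`. -/
def regProduct {d : ℕ} (Θ : Matrix (Fin (d + 1)) (Fin (d + 1)) ℝ) (f g : Emb d → ℂ) (Z : Emb d)
    (χ : 𝓢(Emb d × Emb d, ℂ)) (ε : ℝ) : ℂ :=
  (((2 * Real.pi) ^ (d + 1) : ℝ) : ℂ)⁻¹ *
    ∫ p : Emb d × Emb d,
      χ (ε • p) * f (Z + thetaAct Θ p.1) * g (Z + p.2) *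
        Complex.exp (Complex.I * (mink p.1 p.2 : ℂ))

/-- `(f ×_Θ g)(Z)` exists, for every cut-off function `χ ∈ 𝓢(ℝ^{2n})` with `χ(0,0) = 1` and
independently of it, and equals `w`. -/
def HasDeformedProduct {d : ℕ} (Θ : Matrix (Fin (d + 1)) (Fin (d + 1)) ℝ) (f g : Emb d → ℂ)
    (Z : Emb d) (w : ℂ) : Prop :=
  ∀ χ : 𝓢(Emb d × Emb d, ℂ), χ 0 = 1 → Tendsto (regProduct Θ f g Z χ) (𝓝[>] 0) (𝓝 w)

/-- `[f, g]_Θ (Z) = (f ×_Θ g)(Z) - (g ×_Θ f)(Z)` exists and equals `c`. -/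
def HasDeformedCommutator {d : ℕ} (Θ : Matrix (Fin (d + 1)) (Fin (d + 1)) ℝ) (f g : Emb d → ℂ)
    (Z : Emb d) (c : ℂ) : Prop :=
  ∃ p q : ℂ, HasDeformedProduct Θ f g Z p ∧ HasDeformedProduct Θ g f Z q ∧ c = p - q

/-- The admissible functions on the embedding space: smooth, and all derivatives are bounded by
one and the same power of `1 + |X|` up to constants. -/
def Admissible {d : ℕ} (f : Emb d → ℂ) : Prop :=
  ContDiff ℝ ∞ f ∧ ∃ m : ℕ, ∀ k : ℕ, ∃ C : ℝ, ∀ X : Emb d,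
    ‖iteratedFDeriv ℝ k f X‖ ≤ C * (1 + ‖X‖) ^ m

/-- `f` is an admissible function which agrees with the extension of `φ` to the embedding space
in a neighbourhood of the point with intrinsic coordinates `(t, x)`. -/
def Represents {d : ℕ} (H t : ℝ) (x : Fin d → ℝ) (φ : ℝ → (Fin d → ℝ) → ℂ) (f : Emb d → ℂ) :
    Prop :=
  Admissible f ∧ f =ᶠ[𝓝 (embPoint H t x)] extension H φ

/-- The vector `F^μ = X^μ / X^n` at the point `(t, x)`. -/
def Fvec {d : ℕ} (H t : ℝ) (x : Fin d → ℝ) : Emb d :=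
  WithLp.toLp 2 (fun μ => embPoint H t x μ / embLast H t x)

/-- `Θ^{0b} - Θ^{ρb} F_ρ`. -/
def bracket {d : ℕ} (H t : ℝ) (x : Fin d → ℝ) (Θ : Matrix (Fin (d + 1)) (Fin (d + 1)) ℝ)
    (b : Fin d) : ℝ :=
  Θ 0 b.succ - ∑ ρ, Θ ρ b.succ * lowerIndex (Fvec H t x) ρ

/-- `2i exp(-2Ht) [Θ^{0b} - Θ^{ρb} F_ρ]`. -/
def leadTX {d : ℕ} (H t : ℝ) (x : Fin d → ℝ) (Θ : Matrix (Fin (d + 1)) (Fin (d + 1)) ℝ)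
    (b : Fin d) : ℂ :=
  2 * Complex.I * ((Real.exp (-2 * H * t) * bracket H t x Θ b : ℝ) : ℂ)

/-- `2i exp(-2Ht) [Θ^{ab} - H x^a (Θ^{0b} - Θ^{ρb} F_ρ) + H x^b (Θ^{0a} - Θ^{ρa} F_ρ)]`. -/
def leadXX {d : ℕ} (H t : ℝ) (x : Fin d → ℝ) (Θ : Matrix (Fin (d + 1)) (Fin (d + 1)) ℝ)
    (a b : Fin d) : ℂ :=
  2 * Complex.I * ((Real.exp (-2 * H * t) *
    (Θ a.succ b.succ - H * x a * bracket H t x Θ b + H * x b * bracket H t x Θ a) : ℝ) : ℂ)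

/-- `[f, g]_Θ (Z) = L(Θ) + O(Θ²)` for skew-symmetric `Θ`, where the commutator exists for
every such `Θ`. -/
def CommutatorExpansion {d : ℕ} (f g : Emb d → ℂ) (Z : Emb d)
    (L : Matrix (Fin (d + 1)) (Fin (d + 1)) ℝ → ℂ) : Prop :=
  ∃ C : ℝ, ∀ Θ : Matrix (Fin (d + 1)) (Fin (d + 1)) ℝ, Θ.transpose = -Θ →
    ∃ c : ℂ, HasDeformedCommutator Θ f g Z c ∧
      ∀ r : ℝ, r ≤ 1 → (∀ μ ν, |Θ μ ν| ≤ r) → ‖c - L Θ‖ ≤ C * r ^ 2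

end DeSitter

end

namespace DeSitter

/-! The deformed product is an oscillatory integral with phase ⟪X, LY⟫, where the isometry L lowers
an index. Derivatives of an admissible function decay no better than the function, so convergence
has to come from the phase. Every component of X and Y is a derivative of the phase in a constant
direction. Writing 1 = w (1 + |X|² + |Y|²) with w = `weight`, one integration by parts
(`HasOsc.fderiv_phase_mul`) lowers the order of the amplitude by one; after finitely many rounds the
integral converges absolutely (`UniformSymbol.exists_hasOsc`). All estimates are made for families
with common constants, and this uniformity is what produces the O(Θ²).

For the expansion, f(Z + ΘX) is Taylor expanded in ΘX. The constant term gives f(Z)g(Z) by Fourier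
inversion (`hasOsc_snd`), the linear term gives iΘ^{μν}∂_μf ∂_νg by parts (`hasOsc_linear_mul`), and
the remainder divided by r², for |Θ| of size r, is a uniform family of symbols
(`UniformSymbol.taylorRemainder`). In the commutator fg cancels and skew-symmetry doubles the
bracket (`Admissible.commutatorExpansion`).

The rest is calculus, since the first derivatives at Z depend only on the germ. With u = X^0 + X^n
one has Hu = e^{Ht}, du = δ^0 - F, dt = e^{-Ht} du and dx^b = e^{-Ht}(dX^b - H x^b du). Each
differential carries e^{-Ht}, and skew-symmetry kills the pairing of du with itself. For H|x| < 1
the vector F stays bounded in t, so the prefactor e^{-2Ht} governs the decay. -/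

theorem exists_nonneg_bound {ι D : Type*} [NormedAddCommGroup D] {m : ℝ} {u : ι → D → ℝ}
    (h : ∃ C, ∀ i p, u i p ≤ C * (1 + ‖p‖) ^ m) :
    ∃ C, 0 ≤ C ∧ ∀ i p, u i p ≤ C * (1 + ‖p‖) ^ m := by
  obtain ⟨C, hC⟩ := h
  refine ⟨max C 0, le_max_right _ _, fun i p => (hC i p).trans ?_⟩
  gcongr
  exact le_max_left _ _

/-! ### Calculus of uniform families of symbols -/

section Symbols

variable {ι : Type*} {D E F G : Type*} [NormedAddCommGroup D] [NormedSpace ℝ D]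
  [NormedAddCommGroup E] [NormedSpace ℝ E]
  [NormedAddCommGroup F] [NormedSpace ℝ F] [NormedAddCommGroup G] [NormedSpace ℝ G]

/-- A family of smooth functions all of whose derivatives are bounded by `(1 + ‖p‖) ^ m`, up to
constants that do not depend on the member of the family. -/
structure UniformSymbol (m : ℝ) (a : ι → D → E) : Prop where
  contDiff : ∀ i, ContDiff ℝ ∞ (a i)
  bound : ∀ k : ℕ, ∃ C, ∀ i p, ‖iteratedFDeriv ℝ k (a i) p‖ ≤ C * (1 + ‖p‖) ^ m

/-- The Leibniz estimate for a single order of differentiation. -/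
theorem exists_bound_bilinear (B : E →L[ℝ] F →L[ℝ] G) {m m' : ℝ} {a : ι → D → E} {b : ι → D → F}
    (ha : ∀ i, ContDiff ℝ ∞ (a i)) (hb : ∀ i, ContDiff ℝ ∞ (b i)) (k : ℕ)
    (ha' : ∀ j ≤ k, ∃ C, ∀ i p, ‖iteratedFDeriv ℝ j (a i) p‖ ≤ C * (1 + ‖p‖) ^ m)
    (hb' : ∀ j ≤ k, ∃ C, ∀ i p, ‖iteratedFDeriv ℝ j (b i) p‖ ≤ C * (1 + ‖p‖) ^ m') :
    ∃ C, ∀ i p, ‖iteratedFDeriv ℝ k (fun q => B (a i q) (b i q)) p‖ ≤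
      C * (1 + ‖p‖) ^ (m + m') := by
  choose! Ca hCa0 hCa using fun j hj => exists_nonneg_bound (ha' j hj)
  choose! Cb hCb0 hCb using fun j hj => exists_nonneg_bound (hb' j hj)
  refine ⟨‖B‖ * ∑ j ∈ Finset.range (k + 1), (k.choose j : ℝ) * Ca j * Cb (k - j), fun i p => ?_⟩
  refine (B.norm_iteratedFDeriv_le_of_bilinear (ha i) (hb i) p
    (n := k) (by exact_mod_cast le_top)).trans ?_
  rw [mul_assoc, Finset.sum_mul]
  refine mul_le_mul_of_nonneg_left (Finset.sum_le_sum fun j hj => ?_) (norm_nonneg B)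
  have hj' : j ≤ k := Nat.lt_succ_iff.mp (Finset.mem_range.mp hj)
  have h1 := hCa j hj' i p
  have h2 := hCb (k - j) (Nat.sub_le _ _) i p
  have h3 := hCa0 j hj'
  rw [Real.rpow_add (by positivity : 0 < 1 + ‖p‖)]
  calc (k.choose j : ℝ) * ‖iteratedFDeriv ℝ j (a i) p‖ * ‖iteratedFDeriv ℝ (k - j) (b i) p‖
      ≤ (k.choose j : ℝ) * (Ca j * (1 + ‖p‖) ^ m) * (Cb (k - j) * (1 + ‖p‖) ^ m') := by gcongr
    _ = _ := by ring

namespace UniformSymbol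

theorem bilinear (B : E →L[ℝ] F →L[ℝ] G) {m m' : ℝ} {a : ι → D → E} {b : ι → D → F}
    (ha : UniformSymbol m a) (hb : UniformSymbol m' b) :
    UniformSymbol (m + m') (fun i p => B (a i p) (b i p)) where
  contDiff i := B.isBoundedBilinearMap.contDiff.comp ((ha.contDiff i).prodMk (hb.contDiff i))
  bound k := exists_bound_bilinear B ha.contDiff hb.contDiff k (fun j _ => ha.bound j)
    (fun j _ => hb.bound j)

theorem smul {m m' : ℝ} {a : ι → D → ℝ} {b : ι → D → F}
    (ha : UniformSymbol m a) (hb : UniformSymbol m' b) :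
    UniformSymbol (m + m') (fun i p => a i p • b i p) :=
  ha.bilinear (ContinuousLinearMap.lsmul ℝ ℝ) hb

theorem mul {m m' : ℝ} {a b : ι → D → ℂ}
    (ha : UniformSymbol m a) (hb : UniformSymbol m' b) :
    UniformSymbol (m + m') (fun i p => a i p * b i p) :=
  ha.bilinear (ContinuousLinearMap.mul ℝ ℂ) hb

theorem mono {m m' : ℝ} (h : m ≤ m') {a : ι → D → E} (ha : UniformSymbol m a) :
    UniformSymbol m' a where
  contDiff := ha.contDiff
  bound k := by
    obtain ⟨C, hC0, hC⟩ := exists_nonneg_bound (ha.bound k)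
    refine ⟨C, fun i p => (hC i p).trans ?_⟩
    gcongr
    linarith [norm_nonneg p]

theorem congr {m : ℝ} {a b : ι → D → E} (ha : UniformSymbol m a) (h : ∀ i, a i = b i) :
    UniformSymbol m b := by
  rwa [← funext h]

theorem comp_family {κ : Type*} (σ : κ → ι) {m : ℝ} {a : ι → D → E} (ha : UniformSymbol m a) :
    UniformSymbol m (fun i => a (σ i)) where
  contDiff i := ha.contDiff (σ i)
  bound k := (ha.bound k).imp fun _ hC i p => hC (σ i) p

theorem norm_le {m : ℝ} {a : ι → D → E} (ha : UniformSymbol m a) :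
    ∃ C, 0 ≤ C ∧ ∀ i p, ‖a i p‖ ≤ C * (1 + ‖p‖) ^ m := by
  obtain ⟨C, hC0, hC⟩ := exists_nonneg_bound (ha.bound 0)
  exact ⟨C, hC0, by simpa using hC⟩

theorem fderiv {m : ℝ} {a : ι → D → E} (ha : UniformSymbol m a) :
    UniformSymbol m (fun i => fderiv ℝ (a i)) where
  contDiff i := (ha.contDiff i).fderiv_right (by simp)
  bound k := by simpa only [norm_iteratedFDeriv_fderiv] using ha.bound (k + 1)

theorem of_fderiv {m : ℝ} {a : ι → D → E} (hs : ∀ i, ContDiff ℝ ∞ (a i))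
    (h0 : ∃ C, ∀ i p, ‖a i p‖ ≤ C * (1 + ‖p‖) ^ m)
    (h1 : UniformSymbol m (fun i => _root_.fderiv ℝ (a i))) : UniformSymbol m a where
  contDiff := hs
  bound k := by
    cases k with
    | zero => simpa using h0
    | succ k => simpa only [norm_iteratedFDeriv_fderiv] using h1.bound k

theorem clm (T : E →L[ℝ] F) {m : ℝ} {a : ι → D → E} (ha : UniformSymbol m a) :
    UniformSymbol m (fun i p => T (a i p)) where
  contDiff i := T.contDiff.comp (ha.contDiff i)
  bound k := by
    obtain ⟨C, hC⟩ := ha.bound k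
    refine ⟨‖T‖ * C, fun i p => ?_⟩
    refine (T.norm_iteratedFDeriv_comp_left (ha.contDiff i).contDiffAt
      (n := k) (by exact_mod_cast le_top)).trans ?_
    rw [mul_assoc]
    gcongr
    exact hC i p

theorem fderiv_apply {m : ℝ} {a : ι → D → E} (ha : UniformSymbol m a) (v : D) :
    UniformSymbol m (fun i p => _root_.fderiv ℝ (a i) p v) :=
  ha.fderiv.clm (ContinuousLinearMap.apply ℝ E v)

theorem zero (m : ℝ) : UniformSymbol m (fun (_ : ι) (_ : D) => (0 : E)) where
  contDiff _ := contDiff_const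
  bound k := ⟨0, fun _ p => by simp⟩

theorem add {m : ℝ} {a b : ι → D → E} (ha : UniformSymbol m a) (hb : UniformSymbol m b) :
    UniformSymbol m (fun i p => a i p + b i p) where
  contDiff i := (ha.contDiff i).add (hb.contDiff i)
  bound k := by
    obtain ⟨C, hC⟩ := ha.bound k
    obtain ⟨C', hC'⟩ := hb.bound k
    refine ⟨C + C', fun i p => ?_⟩
    have := iteratedFDeriv_add_apply (𝕜 := ℝ) (x := p) (i := k)
      ((ha.contDiff i).contDiffAt.of_le (by exact_mod_cast le_top))
      ((hb.contDiff i).contDiffAt.of_le (by exact_mod_cast le_top))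
    change ‖iteratedFDeriv ℝ k (a i + b i) p‖ ≤ _
    rw [this, add_mul]
    exact (norm_add_le _ _).trans (add_le_add (hC i p) (hC' i p))

theorem sum {κ : Type*} (s : Finset κ) {m : ℝ} {a : κ → ι → D → E}
    (ha : ∀ j ∈ s, UniformSymbol m (a j)) : UniformSymbol m (fun i p => ∑ j ∈ s, a j i p) := by
  classical
  induction s using Finset.induction_on with
  | empty => simpa using UniformSymbol.zero m
  | insert j s hj ih =>
    simpa only [Finset.sum_insert hj] using (ha j (Finset.mem_insert_self j s)).add
      (ih fun l hl => ha l (Finset.mem_insert_of_mem hl))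

theorem of_bounded_const {c : ι → E} (hc : ∃ C, ∀ i, ‖c i‖ ≤ C) :
    UniformSymbol 0 (fun i (_ : D) => c i) where
  contDiff _ := contDiff_const
  bound k := by
    obtain ⟨C, hC⟩ := hc
    cases k with
    | zero => exact ⟨C, fun i _ => by simpa using hC i⟩
    | succ k => exact ⟨0, fun _ _ => by simp [iteratedFDeriv_const_of_ne (Nat.succ_ne_zero k)]⟩

/-- A primitive, normalized at the origin, of a symbol of order `m ≥ 0` has order `m + 1`. -/
theorem of_fderiv_of_zero {m : ℝ} (hm : 0 ≤ m) {a : ι → D → E} (hs : ∀ i, ContDiff ℝ ∞ (a i))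
    (h0 : ∀ i, a i 0 = 0) (h1 : UniformSymbol m (fun i => _root_.fderiv ℝ (a i))) :
    UniformSymbol (m + 1) a := by
  refine of_fderiv hs ?_ (h1.mono (by linarith))
  obtain ⟨C, hC0, hC⟩ := h1.norm_le
  refine ⟨C, fun i p => ?_⟩
  -- Mean value inequality on the ball through p; `hm` makes the bound at p valid at all its points.
  have key : ∀ x ∈ Metric.closedBall (0 : D) ‖p‖, ‖_root_.fderiv ℝ (a i) x‖ ≤
      C * (1 + ‖p‖) ^ m := fun x hx => (hC i x).trans (by
    have : ‖x‖ ≤ ‖p‖ := by simpa using hx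
    gcongr)
  have h := (convex_closedBall (0 : D) ‖p‖).norm_image_sub_le_of_norm_fderiv_le
    (fun x _ => (hs i).differentiable (by simp) x) key (x := 0) (y := p) (by simp) (by simp)
  rw [h0, sub_zero, sub_zero] at h
  refine h.trans ?_
  rw [Real.rpow_add (by positivity : 0 < 1 + ‖p‖), Real.rpow_one, mul_assoc]
  gcongr
  linarith

theorem linear {c : ι → D →L[ℝ] E} (hc : ∃ C, ∀ i, ‖c i‖ ≤ C) :
    UniformSymbol 1 (fun i p => c i p) := by
  have : UniformSymbol 0 (fun i => _root_.fderiv ℝ (fun p : D => c i p)) := by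
    refine (of_bounded_const hc).congr fun i => ?_
    funext p
    exact ((c i).fderiv).symm
  simpa using of_fderiv_of_zero le_rfl (fun i => (c i).contDiff) (by simp) this

/-- Composition with linear maps. -/
theorem comp_linear {m : ℝ} (hm : 0 ≤ m) {a : ι → E → F} (ha : UniformSymbol m a)
    {A : ι → D →L[ℝ] E} (hA : ∃ C, ∀ i, ‖A i‖ ≤ C) :
    UniformSymbol m (fun i p => a i (A i p)) where
  contDiff i := (ha.contDiff i).comp (A i).contDiff
  bound k := by
    obtain ⟨N, hN⟩ := hA
    obtain ⟨C, hC0, hC⟩ := exists_nonneg_bound (ha.bound k)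
    -- The factor (1 + N)^m comes from 1 + ‖A p‖ ≤ (1 + N)(1 + ‖p‖), and N^k from the chain rule.
    refine ⟨C * (1 + max N 0) ^ m * (max N 0) ^ k, fun i p => ?_⟩
    have hN' : ‖A i‖ ≤ max N 0 := (hN i).trans (le_max_left _ _)
    have h0 : 0 ≤ max N 0 := le_max_right _ _
    have := (A i).iteratedFDeriv_comp_right (ha.contDiff i) p (i := k) (by exact_mod_cast le_top)
    change ‖iteratedFDeriv ℝ k (a i ∘ A i) p‖ ≤ _
    rw [this]
    refine (ContinuousMultilinearMap.norm_compContinuousLinearMap_le _ _).trans ?_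
    rw [Finset.prod_const, Finset.card_univ, Fintype.card_fin]
    have h2 : 1 + ‖A i p‖ ≤ (1 + max N 0) * (1 + ‖p‖) := by
      have := ((A i).le_opNorm p).trans (mul_le_mul_of_nonneg_right hN' (norm_nonneg p))
      nlinarith [norm_nonneg p]
    calc ‖iteratedFDeriv ℝ k (a i) (A i p)‖ * ‖A i‖ ^ k
        ≤ (C * ((1 + max N 0) * (1 + ‖p‖)) ^ m) * (max N 0) ^ k := by
          gcongr
          refine (hC i _).trans ?_
          gcongr
      _ = _ := by rw [Real.mul_rpow (by positivity) (by positivity)]; ring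

/-- The equation ρ' = ρ²g expresses derivatives of order k + 1 through those of order at most k. Its
right-hand side has order -2 - 2 + 1 = -3, so the order -2 reproduces itself by strong induction. -/
theorem of_riccati {ρ : D → ℝ} {g : D → D →L[ℝ] ℝ} (hs : ContDiff ℝ ∞ ρ)
    (h0 : ∃ C, ∀ p, ‖ρ p‖ ≤ C * (1 + ‖p‖) ^ (-2 : ℝ)) (hg : UniformSymbol 1 (fun (_ : ι) => g))
    (h : ∀ p, _root_.fderiv ℝ ρ p = ρ p • ρ p • g p) : UniformSymbol (-2) (fun (_ : ι) => ρ) where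
  contDiff _ := hs
  bound k := by
    induction k using Nat.strong_induction_on with
    | _ k ih =>
      cases k with
      | zero =>
        obtain ⟨C, hC⟩ := h0
        exact ⟨C, fun _ p => by simpa using hC p⟩
      | succ k =>
        -- Only orders up to k are known for ρ at this stage, hence the Leibniz estimate order by
        -- order.
        have h1 : ∀ j ≤ k, _ := fun j hj =>
          exists_bound_bilinear (ι := ι) (m := -2) (ContinuousLinearMap.lsmul ℝ ℝ)
            (fun _ => hs) hg.contDiff j (fun l hl => ih l (by omega)) (fun l _ => hg.bound l)
        have h2 := exists_bound_bilinear (ι := ι) (m := -2) (ContinuousLinearMap.lsmul ℝ ℝ)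
            (fun _ => hs) (fun i => hs.smul (hg.contDiff i)) k (fun l hl => ih l (by omega)) h1
        obtain ⟨C, hC0, hC⟩ := exists_nonneg_bound h2
        refine ⟨C, fun i p => ?_⟩
        rw [← norm_iteratedFDeriv_fderiv, show _root_.fderiv ℝ ρ = _ from funext h]
        refine (hC i p).trans ?_
        gcongr
        · linarith [norm_nonneg p]
        · norm_num

end UniformSymbol

end Symbols

/-! ### The weight as a symbol of order -2 -/

section Weight

variable {V : Type*} [NormedAddCommGroup V] [InnerProductSpace ℝ V]

/-- `(1 + |X|² + |Y|²)⁻¹`. -/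
noncomputable def weight {V : Type*} [NormedAddCommGroup V] (p : V × V) : ℝ := (1 + (‖p.1‖ ^ 2 + ‖p.2‖ ^ 2))⁻¹

theorem contDiff_weight : ContDiff ℝ ∞ (weight (V := V)) := by
  unfold weight
  refine ContDiff.inv ?_ (fun p => by positivity)
  exact contDiff_const.add ((contDiff_fst.norm_sq ℝ).add (contDiff_snd.norm_sq ℝ))

theorem weight_mul {V : Type*} [NormedAddCommGroup V] (p : V × V) : weight p * (1 + (‖p.1‖ ^ 2 + ‖p.2‖ ^ 2)) = 1 :=
  inv_mul_cancel₀ (by positivity)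

/-- The linear form `v ↦ 2 ⟪p, v⟫` on the product, as a linear function of `p`. -/
noncomputable def gradSq : V × V →L[ℝ] V × V →L[ℝ] ℝ :=
  (2 : ℝ) • ((innerSL ℝ).bilinearComp (ContinuousLinearMap.fst ℝ V V)
      (ContinuousLinearMap.fst ℝ V V) +
    (innerSL ℝ).bilinearComp (ContinuousLinearMap.snd ℝ V V) (ContinuousLinearMap.snd ℝ V V))

theorem fderiv_weight (p : V × V) :
    fderiv ℝ (weight (V := V)) p = (-1 : ℝ) • weight p • weight p • gradSq p := by
  have h1 : HasFDerivAt (fun q : V × V => 1 + (‖q.1‖ ^ 2 + ‖q.2‖ ^ 2)) (gradSq p) p := by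
    have := ((hasFDerivAt_fst (𝕜 := ℝ) (p := p)).norm_sq.add
      (hasFDerivAt_snd (𝕜 := ℝ) (p := p)).norm_sq).const_add 1
    convert! this using 1
    ext v <;> simp [gradSq]
  have h2 := (hasDerivAt_inv (x := 1 + (‖p.1‖ ^ 2 + ‖p.2‖ ^ 2)) (by positivity)).comp_hasFDerivAt
    p h1
  rw [show weight (V := V) = Inv.inv ∘ (fun q : V × V => 1 + (‖q.1‖ ^ 2 + ‖q.2‖ ^ 2)) from rfl,
    h2.fderiv]
  ext v <;> simp [sq, mul_assoc]

theorem weight_le {V : Type*} [NormedAddCommGroup V] (p : V × V) : weight p ≤ 2 * (1 + ‖p‖) ^ (-2 : ℝ) := by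
  -- The product carries the sup norm. The constant 2 comes from (1 + s)² ≤ 2(1 + s²).
  have h1 : ‖p‖ ^ 2 ≤ ‖p.1‖ ^ 2 + ‖p.2‖ ^ 2 := by
    rw [Prod.norm_def]
    rcases max_choice ‖p.1‖ ‖p.2‖ with h | h <;> rw [h] <;> nlinarith [norm_nonneg p.1]
  rw [Real.rpow_neg (by positivity), show (2 : ℝ) = ((2 : ℕ) : ℝ) by norm_num, Real.rpow_natCast,
    weight, ← div_eq_mul_inv, inv_eq_one_div, div_le_div_iff₀ (by positivity) (by positivity)]
  push_cast
  nlinarith [sq_nonneg (1 - ‖p‖)]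

theorem UniformSymbol.weight (ι : Type*) :
    UniformSymbol (-2) (fun (_ : ι) => weight (V := V)) := by
  refine UniformSymbol.of_riccati contDiff_weight ⟨2, fun p => ?_⟩
    (UniformSymbol.linear (c := fun _ => (-1 : ℝ) • gradSq) ⟨_, fun _ => le_rfl⟩ |>.congr
      fun _ => funext fun _ => rfl) (g := fun p => (-1 : ℝ) • gradSq p) fun p => ?_
  · rw [Real.norm_of_nonneg (by unfold DeSitter.weight; positivity)]
    exact weight_le p
  · rw [fderiv_weight, smul_comm (-1 : ℝ), smul_comm (-1 : ℝ)]

end Weight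

/-! ### Schwartz cut-offs -/

section Schwartz

variable {E : Type*} [NormedAddCommGroup E] [NormedSpace ℝ E]

/-- The Schwartz function `p ↦ χ(εp)`. -/
theorem exists_schwartz_dilation (χ : 𝓢(E, ℂ)) {ε : ℝ} (hε : ε ≠ 0) :
    ∃ ψ : 𝓢(E, ℂ), ∀ p, ψ p = χ (ε • p) :=
  ⟨SchwartzMap.compCLMOfContinuousLinearEquiv ℂ
    (ContinuousLinearEquiv.smulLeft (R₁ := ℝ) (M₁ := E) (Units.mk0 ε hε)) χ, fun _ => rfl⟩

theorem exists_schwartz_bump (E : Type*) [NormedAddCommGroup E] [NormedSpace ℝ E]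
    [FiniteDimensional ℝ E] : ∃ φ : 𝓢(E, ℂ), HasCompactSupport φ ∧ φ 0 = 1 := by
  obtain ⟨φ⟩ : Nonempty (ContDiffBump (0 : E)) := inferInstance
  have hs : HasCompactSupport (fun p => ((φ p : ℝ) : ℂ)) :=
    φ.hasCompactSupport.comp_left (g := fun r : ℝ => (r : ℂ)) Complex.ofReal_zero
  have hd : ContDiff ℝ ∞ (fun p => ((φ p : ℝ) : ℂ)) := Complex.ofRealCLM.contDiff.comp φ.contDiff
  refine ⟨hs.toSchwartzMap hd, hs, ?_⟩
  change ((φ 0 : ℝ) : ℂ) = 1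
  rw [φ.one_of_mem_closedBall (by simp [φ.rIn_pos.le])]
  simp

variable [FiniteDimensional ℝ E] [MeasurableSpace E] [BorelSpace E] {μ : Measure E}
  [μ.IsAddHaarMeasure]

theorem integrable_schwartz_mul (χ : 𝓢(E, ℂ)) {a : E → ℂ} (ha : Continuous a) {m C : ℝ}
    (hC0 : 0 ≤ C) (hC : ∀ p, ‖a p‖ ≤ C * (1 + ‖p‖) ^ m) : Integrable (fun p => χ p * a p) μ := by
  -- For negative m this is 0; the comparison of powers still holds because the base is at least 1.
  set k := ⌈m⌉₊
  have hint : Integrable (fun p : E => C * 2 ^ k * (‖χ p‖ + ‖p‖ ^ k * ‖χ p‖)) μ :=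
    (χ.integrable.norm.add (χ.integrable_pow_mul μ k)).const_mul _
  refine hint.mono' (χ.continuous.mul ha).aestronglyMeasurable (ae_of_all _ fun p => ?_)
  rw [norm_mul]
  have h1 : (1 + ‖p‖) ^ m ≤ 2 ^ k * (1 + ‖p‖ ^ k) := by
    calc (1 + ‖p‖) ^ m ≤ (1 + ‖p‖) ^ (k : ℝ) :=
          Real.rpow_le_rpow_of_exponent_le (by linarith [norm_nonneg p]) (Nat.le_ceil m)
      _ = (1 + ‖p‖) ^ k := Real.rpow_natCast _ _
      _ ≤ (2 * max 1 ‖p‖) ^ k := by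
          gcongr
          linarith [le_max_left 1 ‖p‖, le_max_right 1 ‖p‖]
      _ = 2 ^ k * (max 1 ‖p‖) ^ k := mul_pow _ _ _
      _ ≤ 2 ^ k * (1 + ‖p‖ ^ k) := by
          gcongr
          rcases max_choice 1 ‖p‖ with h | h <;> rw [h]
          · simp
          · linarith
  calc ‖χ p‖ * ‖a p‖ ≤ ‖χ p‖ * (C * (2 ^ k * (1 + ‖p‖ ^ k))) := by
        gcongr
        exact (hC p).trans (by gcongr)
    _ = _ := by ring

end Schwartz

/-! ### Existence of oscillatory integrals -/

section Oscillatory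

variable {ι V : Type*} [NormedAddCommGroup V] [InnerProductSpace ℝ V]

/-- The phase function `⟪X, L Y⟫`. -/
noncomputable def phase (L : V ≃ₗᵢ[ℝ] V) (p : V × V) : ℝ := inner ℝ p.1 (L p.2)

/-- The oscillating factor `exp(i ⟪X, L Y⟫)`. -/
noncomputable def osc (L : V ≃ₗᵢ[ℝ] V) (p : V × V) : ℂ := Complex.exp (Complex.I * (phase L p : ℂ))

variable (L : V ≃ₗᵢ[ℝ] V)

theorem hasFDerivAt_phase (p : V × V) :
    HasFDerivAt (phase L) ((innerSL ℝ (L p.2)).comp (ContinuousLinearMap.fst ℝ V V) +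
      (innerSL ℝ (L.symm p.1)).comp (ContinuousLinearMap.snd ℝ V V)) p := by
  have h := (hasFDerivAt_fst (𝕜 := ℝ) (p := p)).inner ℝ
    ((L : V →L[ℝ] V).hasFDerivAt.comp p (hasFDerivAt_snd (𝕜 := ℝ) (p := p)))
  convert! h using 1
  ext v
  · simp [real_inner_comm]
  · simp only [ContinuousLinearMap.comp_apply, add_apply,
      ContinuousLinearMap.inr_apply]
    simp [← L.inner_map_map (L.symm p.1) v]

theorem fderiv_phase_apply (p v : V × V) :
    fderiv ℝ (phase L) p v = inner ℝ (L p.2) v.1 + inner ℝ (L.symm p.1) v.2 := by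
  simp [(hasFDerivAt_phase L p).fderiv]

theorem contDiff_phase : ContDiff ℝ ∞ (phase L) :=
  contDiff_fst.inner ℝ ((L : V →L[ℝ] V).contDiff.comp contDiff_snd)

theorem hasFDerivAt_osc (p : V × V) :
    HasFDerivAt (osc L) (osc L p • Complex.I • Complex.ofRealCLM.comp (fderiv ℝ (phase L) p)) p := by
  have h : HasFDerivAt (phase L) (fderiv ℝ (phase L) p) p :=
    ((contDiff_phase L).differentiable (by simp) p).hasFDerivAt
  have h2 := ((Complex.ofRealCLM.hasFDerivAt.comp p h).const_mul Complex.I).cexp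
  exact h2

theorem fderiv_osc_apply (p v : V × V) :
    fderiv ℝ (osc L) p v = Complex.I * (fderiv ℝ (phase L) p v : ℂ) * osc L p := by
  rw [(hasFDerivAt_osc L p).fderiv]
  simp [mul_comm, mul_left_comm]

theorem norm_osc (p : V × V) : ‖osc L p‖ = 1 := by
  rw [osc, mul_comm, Complex.norm_exp_ofReal_mul_I]

theorem continuous_osc : Continuous (osc L) := by
  have := (contDiff_phase L).continuous
  unfold osc
  fun_prop

variable [FiniteDimensional ℝ V] [MeasurableSpace V] [BorelSpace V]

instance isAddHaarMeasure_volume_prod : (volume : Measure (V × V)).IsAddHaarMeasure :=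
  inferInstanceAs ((volume : Measure V).prod (volume : Measure V)).IsAddHaarMeasure

/-- The oscillatory integral of `a exp(i ⟪X, L Y⟫)`, regularized by Schwartz cut-off functions,
exists and equals `I`. -/
def HasOsc (L : V ≃ₗᵢ[ℝ] V) (a : V × V → ℂ) (I : ℂ) : Prop :=
  ∀ χ : 𝓢(V × V, ℂ), Tendsto (fun ε : ℝ => ∫ p, χ (ε • p) * a p * osc L p) (𝓝[>] 0) (𝓝 (χ 0 * I))

variable {L}

theorem UniformSymbol.integrable_schwartz_mul {a : ι → V × V → ℂ} {m : ℝ} (ha : UniformSymbol m a)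
    (χ : 𝓢(V × V, ℂ)) {ε : ℝ} (hε : ε ≠ 0) (i : ι) :
    Integrable (fun p => χ (ε • p) * a i p * osc L p) := by
  obtain ⟨ψ, hψ⟩ := exists_schwartz_dilation χ hε
  obtain ⟨C, hC0, hC⟩ := ha.norm_le
  simp only [← hψ, mul_assoc]
  refine DeSitter.integrable_schwartz_mul ψ ((ha.contDiff i).continuous.mul (continuous_osc L))
    hC0 (m := m) fun p => ?_
  rw [norm_mul, norm_osc, mul_one]
  exact hC i p

/-- A cut-off with value 1 at the origin recovers the integral, so values found along different
decompositions of one amplitude may be compared. -/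
theorem HasOsc.unique {a : V × V → ℂ} {I J : ℂ} (hI : HasOsc L a I) (hJ : HasOsc L a J) :
    I = J := by
  obtain ⟨φ, -, h0⟩ := exists_schwartz_bump (V × V)
  simpa [h0] using tendsto_nhds_unique (hI φ) (hJ φ)

theorem HasOsc.add {a b : V × V → ℂ} {m : ℝ} (ha : UniformSymbol m (fun _ : Unit => a))
    (hb : UniformSymbol m (fun _ : Unit => b)) {I J : ℂ} (hI : HasOsc L a I) (hJ : HasOsc L b J) :
    HasOsc L (fun p => a p + b p) (I + J) := by
  intro χ
  rw [mul_add]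
  refine ((hI χ).add (hJ χ)).congr' ?_
  filter_upwards [self_mem_nhdsWithin] with ε hε
  rw [← integral_add (ha.integrable_schwartz_mul χ hε.ne' ())
    (hb.integrable_schwartz_mul χ hε.ne' ())]
  congr 1 with p
  ring

theorem HasOsc.const_mul {a : V × V → ℂ} {I : ℂ} (c : ℂ) (hI : HasOsc L a I) :
    HasOsc L (fun p => c * a p) (c * I) := by
  intro χ
  rw [mul_left_comm]
  refine ((hI χ).const_mul c).congr fun ε => ?_
  rw [← integral_const_mul]
  congr 1 with p
  ring

theorem HasOsc.sum {κ : Type*} (s : Finset κ) {a : κ → V × V → ℂ} {m : ℝ}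
    (ha : ∀ j ∈ s, UniformSymbol m (fun _ : Unit => a j)) {I : κ → ℂ}
    (hI : ∀ j ∈ s, HasOsc L (a j) (I j)) :
    HasOsc L (fun p => ∑ j ∈ s, a j p) (∑ j ∈ s, I j) := by
  intro χ
  rw [Finset.mul_sum]
  refine (tendsto_finsetSum s fun j hj => hI j hj χ).congr' ?_
  filter_upwards [self_mem_nhdsWithin] with ε hε
  rw [← integral_finsetSum s fun j hj => (ha j hj).integrable_schwartz_mul χ hε.ne' ()]
  congr 1 with p
  rw [Finset.mul_sum, Finset.sum_mul]

/-- Integration by parts: `DΦ · v` acts as `i ∂_v`. -/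
theorem HasOsc.fderiv_phase_mul {a : V × V → ℂ} {m : ℝ}
    (ha : UniformSymbol m (fun _ : Unit => a)) {v : V × V} {I J : ℂ} (hJ : HasOsc L a J)
    (hI : HasOsc L (fun p => fderiv ℝ a p v) I) :
    HasOsc L (fun p => ((fderiv ℝ (phase L) p v : ℝ) : ℂ) * a p) (Complex.I * I) := by
  intro χ
  have hphase : UniformSymbol 1 (fun (_ : Unit) (p : V × V) => (fderiv ℝ (phase L) p v : ℂ)) := by
    refine UniformSymbol.linear (c := fun _ => Complex.ofRealCLM.comp
      ((innerSL ℝ v.1).comp ((L : V →L[ℝ] V).comp (ContinuousLinearMap.snd ℝ V V)) +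
      (innerSL ℝ v.2).comp ((L.symm : V →L[ℝ] V).comp (ContinuousLinearMap.fst ℝ V V))))
      ⟨_, fun _ => le_rfl⟩ |>.congr fun _ => funext fun p => ?_
    rw [fderiv_phase_apply, real_inner_comm, real_inner_comm v.2]
    simp
  have ha' := ha.fderiv_apply v
  have hχ : ∀ p, (SchwartzMap.evalCLM ℂ (V × V) ℂ v (SchwartzMap.fderivCLM ℂ (V × V) ℂ χ)) p =
      fderiv ℝ χ p v := fun p => by simp
  set χ' := SchwartzMap.evalCLM ℂ (V × V) ℂ v (SchwartzMap.fderivCLM ℂ (V × V) ℂ χ)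
  have hε0 : Tendsto (fun ε : ℝ => (ε : ℂ)) (𝓝[>] 0) (𝓝 0) := by
    have : Tendsto (fun ε : ℝ => (ε : ℂ)) (𝓝 0) (𝓝 ((0 : ℝ) : ℂ)) :=
      Complex.continuous_ofReal.tendsto 0
    simpa using this.mono_left nhdsWithin_le_nhds
  -- The derivative falling on the cut-off brings a factor ε. The integral it multiplies converges
  -- because `HasOsc` admits cut-offs with any value at the origin, such as χ'.
  have key := (((hε0.mul (hJ χ')).add (hI χ)).const_mul Complex.I)
  rw [zero_mul, zero_add, mul_left_comm] at key
  refine key.congr' ?_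
  filter_upwards [self_mem_nhdsWithin] with ε hε
  have hε : ε ≠ 0 := (Set.mem_Ioi.mp hε).ne'
  have hu : ∀ p, HasFDerivAt (fun q => χ (ε • q) * a q)
      (χ (ε • p) • fderiv ℝ a p + a p • (fderiv ℝ χ (ε • p)).comp (ε • ContinuousLinearMap.id ℝ _))
      p := fun p =>
    ((χ.differentiableAt.hasFDerivAt).comp p ((hasFDerivAt_id p).const_smul ε)).mul
      ((ha.contDiff ()).differentiable (by simp) p).hasFDerivAt
  have hu' : ∀ p, fderiv ℝ (fun q => χ (ε • q) * a q) p v =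
      χ (ε • p) * fderiv ℝ a p v + ε * (χ' (ε • p) * a p) := fun p => by
    rw [(hu p).fderiv, hχ]
    simp
    ring
  have i1 := ha'.integrable_schwartz_mul (L := L) χ hε ()
  have i2 := ha.integrable_schwartz_mul (L := L) χ' hε ()
  have i3 := (hphase.mul ha).integrable_schwartz_mul (L := L) χ hε ()
  have parts := integral_mul_fderiv_eq_neg_fderiv_mul_of_integrable (μ := volume) (v := v)
    (f := fun q => χ (ε • q) * a q) (g := osc L)
    (by
      refine (i1.add (i2.const_mul (ε : ℂ))).congr (ae_of_all _ fun p => ?_)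
      simp only [hu', Pi.add_apply]
      ring)
    (by
      refine (i3.const_mul Complex.I).congr (ae_of_all _ fun p => ?_)
      simp only [fderiv_osc_apply]
      ring)
    (ha.integrable_schwartz_mul χ hε ())
    (fun p _ => (hu p).differentiableAt) (fun p _ => (hasFDerivAt_osc L p).differentiableAt)
  have e1 : ∫ p, χ (ε • p) * a p * fderiv ℝ (osc L) p v =
      Complex.I * ∫ p, χ (ε • p) * ((fderiv ℝ (phase L) p v : ℂ) * a p) * osc L p := by
    rw [← integral_const_mul]
    congr 1 with p
    rw [fderiv_osc_apply]
    ring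
  have e2 : ∫ p, fderiv ℝ (fun q => χ (ε • q) * a q) p v * osc L p =
      ε * (∫ p, χ' (ε • p) * a p * osc L p) + ∫ p, χ (ε • p) * fderiv ℝ a p v * osc L p := by
    rw [← integral_const_mul, ← integral_add (i2.const_mul _) i1]
    congr 1 with p
    rw [hu']
    ring
  rw [e1, e2] at parts
  have := congrArg (fun z => -Complex.I * z) parts
  simp only [← mul_assoc, neg_mul, Complex.I_mul_I, neg_neg, one_mul, mul_neg] at this
  simp only [← mul_assoc, this]

/-- Symbols of sufficiently negative order: the integral converges absolutely. -/
theorem UniformSymbol.exists_hasOsc_of_integrable {a : ι → V × V → ℂ} {m : ℝ}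
    (hm : m < -(Module.finrank ℝ (V × V) : ℝ)) (ha : UniformSymbol m a) :
    ∃ B, ∀ i, ∃ I, HasOsc L (a i) I ∧ ‖I‖ ≤ B := by
  obtain ⟨C, hC0, hC⟩ := ha.norm_le
  have hint : Integrable (fun p : V × V => C * (1 + ‖p‖) ^ m) := by
    have := integrable_one_add_norm (E := V × V) (μ := volume) (r := -m) (by linarith)
    simpa using this.const_mul C
  refine ⟨∫ p : V × V, C * (1 + ‖p‖) ^ m, fun i => ⟨∫ p, a i p * osc L p, fun χ => ?_, ?_⟩⟩
  · rw [← integral_const_mul]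
    refine tendsto_integral_filter_of_dominated_convergence
      (fun p => SchwartzMap.seminorm ℝ 0 0 χ * (C * (1 + ‖p‖) ^ m)) ?_ ?_ (hint.const_mul _) ?_
    · refine Eventually.of_forall fun ε => Continuous.aestronglyMeasurable ?_
      have := (ha.contDiff i).continuous
      have := continuous_osc L
      fun_prop
    · refine Eventually.of_forall fun ε => ae_of_all _ fun p => ?_
      rw [norm_mul, norm_mul, norm_osc, mul_one]
      gcongr
      · exact χ.norm_le_seminorm ℝ _
      · exact hC i p
    · refine ae_of_all _ fun p => ?_
      have h : Tendsto (fun ε : ℝ => χ (ε • p)) (𝓝 0) (𝓝 (χ ((0 : ℝ) • p))) :=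
        Continuous.tendsto (by fun_prop) 0
      rw [zero_smul] at h
      simpa only [mul_assoc] using (h.mono_left nhdsWithin_le_nhds).mul_const (a i p * osc L p)
  · refine norm_integral_le_of_norm_le hint (ae_of_all _ fun p => ?_)
    rw [norm_mul, norm_osc, mul_one]
    exact hC i p

/-- Oscillatory integrals of symbols of arbitrary order exist, with bounds that are uniform in
families. -/
theorem UniformSymbol.exists_hasOsc {a : ι → V × V → ℂ} {m : ℝ} (ha : UniformSymbol m a) :
    ∃ B, ∀ i, ∃ I, HasOsc L (a i) I ∧ ‖I‖ ≤ B := by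
  -- N bounds the number of integrations by parts needed for absolute convergence.
  obtain ⟨N, hN⟩ : ∃ N : ℕ, m - N < -(Module.finrank ℝ (V × V) : ℝ) := by
    obtain ⟨N, hN⟩ := exists_nat_gt (m + Module.finrank ℝ (V × V))
    exact ⟨N, by linarith⟩
  induction N generalizing m a with
  | zero => exact ha.exists_hasOsc_of_integrable (by simpa using hN)
  | succ N ih =>
    have hm' : m - 1 - N < -(Module.finrank ℝ (V × V) : ℝ) := by
      push_cast at hN
      linarith
    have hw := UniformSymbol.weight (V := V) ι
    set e := stdOrthonormalBasis ℝ V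
    -- the directions `v` with `DΦ(p) v = c p`
    let c : Fin (Module.finrank ℝ V) ⊕ Fin (Module.finrank ℝ V) → V × V →L[ℝ] ℝ := fun j =>
      j.elim (fun j => (innerSL ℝ (e j)).comp (ContinuousLinearMap.fst ℝ V V))
        (fun j => (innerSL ℝ (e j)).comp (ContinuousLinearMap.snd ℝ V V))
    let v : Fin (Module.finrank ℝ V) ⊕ Fin (Module.finrank ℝ V) → V × V := fun j =>
      j.elim (fun j => (0, L.symm (e j))) (fun j => (L (e j), 0))
    have hcv : ∀ j p, _root_.fderiv ℝ (phase L) p (v j) = c j p := by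
      rintro (j | j) p <;> simp [c, v, fderiv_phase_apply, real_inner_comm]
    have hsum : ∀ p, ∑ j, c j p * c j p = ‖p.1‖ ^ 2 + ‖p.2‖ ^ 2 := by
      intro p
      rw [Fintype.sum_sum_type, ← e.sum_sq_norm_inner_right p.1, ← e.sum_sq_norm_inner_right p.2]
      simp [c, sq]
    have h0 : UniformSymbol (m - 1) (fun i p => DeSitter.weight p • a i p) :=
      (hw.smul ha).mono (by linarith)
    have hb : ∀ j, UniformSymbol (m - 1) (fun i p => c j p • DeSitter.weight p • a i p) :=
      fun j => ((UniformSymbol.linear (c := fun _ => c j) ⟨_, fun _ => le_rfl⟩).smul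
        (hw.smul ha)).mono (by linarith)
    obtain ⟨B0, hB0⟩ := ih h0 hm'
    choose I0 hI0 hI0B using hB0
    have hB1 := fun j => ih (hb j) hm'
    have hB2 := fun j => ih ((hb j).fderiv_apply (v j)) hm'
    choose B1 hB1 using hB1
    choose I1 hI1 hI1B using hB1
    choose B2 hB2 using hB2
    choose I2 hI2 hI2B using hB2
    refine ⟨B0 + ∑ j, B2 j, fun i => ⟨I0 i + ∑ j, Complex.I * I2 j i, ?_, ?_⟩⟩
    -- The identity w + ∑ c_j² w = 1. One factor c_j is a derivative of the phase and is integrated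
    -- away; what remains, c_j w a, has order m - 1.
    · have hdecomp : a i = fun p => DeSitter.weight p • a i p + ∑ j,
          ((_root_.fderiv ℝ (phase L) p (v j) : ℝ) : ℂ) * (c j p • DeSitter.weight p • a i p) := by
        funext p
        simp only [hcv, Complex.real_smul]
        have h1 := weight_mul p
        rw [← hsum p] at h1
        have h2 := congrArg (fun r : ℝ => (r : ℂ) * a i p) h1
        simp only [Complex.ofReal_mul, Complex.ofReal_add, Complex.ofReal_sum, Complex.ofReal_one,
          one_mul] at h2
        conv_lhs => rw [← h2]
        rw [mul_add, add_mul, mul_one, Finset.mul_sum, Finset.sum_mul]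
        congr 1
        refine Finset.sum_congr rfl fun j _ => ?_
        ring
      have hs : ∀ j, UniformSymbol m (fun (_ : Unit) (p : V × V) =>
          ((_root_.fderiv ℝ (phase L) p (v j) : ℝ) : ℂ) * (c j p • DeSitter.weight p • a i p)) := by
        intro j
        simp only [hcv]
        have := (UniformSymbol.linear (ι := Unit) (c := fun _ => c j) ⟨_, fun _ => le_rfl⟩).smul
          ((hb j).comp_family (fun _ : Unit => i))
        simpa [Complex.real_smul] using this
      have hI := HasOsc.sum Finset.univ (fun j _ => hs j) fun j _ => HasOsc.fderiv_phase_mul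
          ((hb j).comp_family fun _ => i) (hI1 j i) (hI2 j i)
      rw [hdecomp]
      exact HasOsc.add ((h0.comp_family fun _ => i).mono (by linarith))
        (UniformSymbol.sum _ fun j _ => hs j) (hI0 i) hI
    · refine (norm_add_le _ _).trans (add_le_add (hI0B i) ((norm_sum_le _ _).trans
        (Finset.sum_le_sum fun j _ => ?_)))
      simpa using hI2B j i

end Oscillatory

/-! ### Values of the constant and linear terms -/

section Evaluation

variable {ι V : Type*} [NormedAddCommGroup V] [InnerProductSpace ℝ V]

open scoped FourierTransform in
/-- The Fourier transform with the normalization `∫ φ(X) exp(i ⟪X, L Y⟫) dX`, as a Schwartz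
function of `Y`, and its integral. -/
theorem exists_schwartz_integral_osc [FiniteDimensional ℝ V] [MeasurableSpace V] [BorelSpace V]
    (L : V ≃ₗᵢ[ℝ] V) (φ : 𝓢(V, ℂ)) :
    ∃ ψ : 𝓢(V, ℂ), (∀ y, ψ y = ∫ x, φ x * osc L (x, y)) ∧
      ∫ y, ψ y = ((2 * Real.pi) ^ Module.finrank ℝ V : ℝ) * φ 0 := by
  have hpi : -(2 * Real.pi)⁻¹ ≠ 0 := by simp [Real.pi_ne_zero]
  -- The phase -2π⟪x, w⟫ of `𝓕` becomes ⟪x, L y⟫ at w = -(2π)⁻¹ L y.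
  obtain ⟨ψ₀, hψ₀⟩ := exists_schwartz_dilation (𝓕 φ) hpi
  let ψ := SchwartzMap.compCLMOfContinuousLinearEquiv ℂ L.toContinuousLinearEquiv ψ₀
  have hψ : ∀ y, ψ y = 𝓕 φ (-(2 * Real.pi)⁻¹ • L y) := fun y => hψ₀ _
  refine ⟨ψ, fun y => ?_, ?_⟩
  · rw [hψ, SchwartzMap.fourier_coe, Real.fourier_eq']
    congr 1 with x
    rw [smul_eq_mul, mul_comm, osc, phase, inner_smul_right]
    congr 2
    have : (Real.pi : ℂ) ≠ 0 := by exact_mod_cast Real.pi_ne_zero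
    push_cast
    field_simp
  · simp only [hψ]
    -- The isometry preserves volume, the dilation contributes (2π)^n, and inversion at 0 gives ∫ 𝓕φ
    -- = φ(0).
    have h1 := L.measurePreserving.integral_comp L.toHomeomorph.measurableEmbedding
      (fun w => 𝓕 φ (-(2 * Real.pi)⁻¹ • w))
    have h2 := Measure.integral_comp_smul volume (fun w => 𝓕 φ w) (-(2 * Real.pi)⁻¹)
    have h3 : ∫ w, 𝓕 φ w = φ 0 := by
      have : 𝓕⁻ (𝓕 φ) 0 = φ 0 := by rw [FourierTransform.fourierInv_fourier_eq]
      rw [← this, SchwartzMap.fourierInv_coe, Real.fourierInv_eq']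
      simp
    refine h1.trans (h2.trans ?_)
    rw [h3, Complex.real_smul]
    congr 2
    rw [abs_inv, abs_pow, abs_neg, abs_inv, inv_pow, inv_inv, abs_of_pos Real.two_pi_pos]

variable {L : V ≃ₗᵢ[ℝ] V}

theorem UniformSymbol.comp_fst {F : Type*} [NormedAddCommGroup F] [NormedSpace ℝ F] {m : ℝ}
    (hm : 0 ≤ m) {f : ι → V → F} (hf : UniformSymbol m f) :
    UniformSymbol m (fun i (p : V × V) => f i p.1) :=
  hf.comp_linear hm (A := fun _ => ContinuousLinearMap.fst ℝ V V) ⟨_, fun _ => le_rfl⟩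

theorem UniformSymbol.comp_snd {F : Type*} [NormedAddCommGroup F] [NormedSpace ℝ F] {m : ℝ}
    (hm : 0 ≤ m) {f : ι → V → F} (hf : UniformSymbol m f) :
    UniformSymbol m (fun i (p : V × V) => f i p.2) :=
  hf.comp_linear hm (A := fun _ => ContinuousLinearMap.snd ℝ V V) ⟨_, fun _ => le_rfl⟩

variable [FiniteDimensional ℝ V] [MeasurableSpace V] [BorelSpace V]

/-- Existence being known, a single cut-off determines the value. A product of two bumps permits
Fubini and turns the X-integral into a Fourier transform concentrating at Y = 0. -/
theorem hasOsc_snd {m : ℝ} (hm : 0 ≤ m) {g : V → ℂ} (hg : UniformSymbol m (fun _ : Unit => g)) :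
    HasOsc L (fun p => g p.2) (((2 * Real.pi) ^ Module.finrank ℝ V : ℝ) * g 0) := by
  have hg2 := hg.comp_snd hm
  obtain ⟨_, hB⟩ := hg2.exists_hasOsc (L := L)
  obtain ⟨I, hI, -⟩ := hB ()
  convert hI using 1
  obtain ⟨φ, hφc, hφ0⟩ := exists_schwartz_bump V
  obtain ⟨ψ, hψ, hψint⟩ := exists_schwartz_integral_osc L φ
  have hχc : HasCompactSupport (fun p : V × V => φ p.1 * φ p.2) := by
    refine HasCompactSupport.intro (hφc.isCompact.prod hφc.isCompact) fun p hp => ?_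
    by_cases h1 : p.1 ∈ tsupport φ
    · have h2 : p.2 ∉ tsupport φ := fun h2 => hp ⟨h1, h2⟩
      rw [image_eq_zero_of_notMem_tsupport h2, mul_zero]
    · rw [image_eq_zero_of_notMem_tsupport h1, zero_mul]
  have hχd : ContDiff ℝ ∞ (fun p : V × V => φ p.1 * φ p.2) :=
    ((φ.smooth ⊤).comp contDiff_fst).mul ((φ.smooth ⊤).comp contDiff_snd)
  set χ := hχc.toSchwartzMap hχd
  have hχ : ∀ p, χ p = φ p.1 * φ p.2 := fun p => rfl
  have hlim := hI χ
  rw [hχ, Prod.fst_zero, Prod.snd_zero, hφ0, one_mul, one_mul] at hlim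
  refine tendsto_nhds_unique ?_ hlim
  -- Scaling x by ε⁻¹ and then y by ε: the Jacobians ε^{-n} and ε^n cancel, and the fixed Schwartz
  -- function ψ dominates the limit.
  have hform : ∀ ε : ℝ, 0 < ε → ∫ p : V × V, χ (ε • p) * g p.2 * osc L p =
      ∫ y, φ (ε • ε • y) * g (ε • y) * ψ y := by
    intro ε hε
    have hinner : ∀ y, ∫ x, χ (ε • (x, y)) * g y * osc L (x, y) =
        ((ε ^ Module.finrank ℝ V)⁻¹ : ℝ) • (φ (ε • y) * g y * ψ (ε⁻¹ • y)) := by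
      intro y
      have h := Measure.integral_comp_smul_of_nonneg volume
        (fun x => φ x * osc L (x, ε⁻¹ • y)) ε (hR := hε.le)
      rw [← hψ] at h
      rw [← mul_smul_comm, ← h, ← integral_const_mul]
      congr 1 with x
      have : osc L (ε • x, ε⁻¹ • y) = osc L (x, y) := by
        simp only [osc, phase, map_smul, inner_smul_left, inner_smul_right]
        simp [hε.ne']
      rw [this, hχ]
      simp only [Prod.smul_mk]
      ring
    have hint := hg2.integrable_schwartz_mul (L := L) χ hε.ne' ()
    rw [show (volume : Measure (V × V)) = (volume : Measure V).prod volume from rfl] at hint ⊢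
    rw [integral_prod_symm _ hint]
    simp only [hinner]
    rw [integral_smul]
    have h := Measure.integral_comp_smul_of_nonneg volume
        (fun y => φ (ε • ε • y) * g (ε • y) * ψ y) ε⁻¹ (hR := (inv_pos.mpr hε).le)
    simp only [smul_inv_smul₀ hε.ne'] at h
    rw [h, smul_smul, inv_pow, inv_inv, inv_mul_cancel₀ (pow_ne_zero _ hε.ne'), one_smul]
  obtain ⟨C, hC0, hC⟩ := hg.norm_le
  have hbound : Integrable
      (fun y => SchwartzMap.seminorm ℝ 0 0 φ * (C * ‖ψ y * ((1 + ‖y‖) ^ m : ℝ)‖)) := by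
    refine ((integrable_schwartz_mul ψ ?_ zero_le_one (m := m) fun y => ?_).norm.const_mul
      _).const_mul _
    · refine Complex.continuous_ofReal.comp (Continuous.rpow_const (by fun_prop) fun y => ?_)
      exact Or.inl (by positivity)
    · rw [Complex.norm_real, Real.norm_of_nonneg (by positivity), one_mul]
  have hT : Tendsto (fun ε : ℝ => ∫ y, φ (ε • ε • y) * g (ε • y) * ψ y) (𝓝[>] 0)
      (𝓝 (∫ y, g 0 * ψ y)) := by
    refine tendsto_integral_filter_of_dominated_convergence _ ?_ ?_ hbound ?_
    · refine Eventually.of_forall fun ε => Continuous.aestronglyMeasurable ?_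
      have := (hg.contDiff ()).continuous
      fun_prop
    · filter_upwards [Ioo_mem_nhdsGT one_pos] with ε hε
      refine ae_of_all _ fun y => ?_
      have h1 : ‖g (ε • y)‖ ≤ C * (1 + ‖y‖) ^ m := by
        refine (hC () _).trans ?_
        gcongr
        rw [norm_smul, Real.norm_of_nonneg hε.1.le]
        exact mul_le_of_le_one_left (norm_nonneg y) hε.2.le
      rw [norm_mul, norm_mul, norm_mul, Complex.norm_real,
        Real.norm_of_nonneg (by positivity : 0 ≤ (1 + ‖y‖) ^ m)]
      calc ‖φ (ε • ε • y)‖ * ‖g (ε • y)‖ * ‖ψ y‖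
          ≤ SchwartzMap.seminorm ℝ 0 0 φ * (C * (1 + ‖y‖) ^ m) * ‖ψ y‖ := by
            gcongr
            exact φ.norm_le_seminorm ℝ _
        _ = _ := by ring
    · refine ae_of_all _ fun y => ?_
      have := (hg.contDiff ()).continuous
      have h : Tendsto (fun ε : ℝ => φ (ε • ε • y) * g (ε • y) * ψ y) (𝓝 0)
          (𝓝 (φ ((0 : ℝ) • (0 : ℝ) • y) * g ((0 : ℝ) • y) * ψ y)) :=
        Continuous.tendsto (by fun_prop) 0
      simp only [zero_smul, hφ0, one_mul] at h
      exact h.mono_left nhdsWithin_le_nhds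
  rw [integral_const_mul, hψint, hφ0, mul_one, mul_comm] at hT
  refine hT.congr' ?_
  filter_upwards [self_mem_nhdsWithin] with ε hε
  exact (hform ε hε).symm

/-- The component ⟪e_j, X⟫ is the derivative of the phase in the direction (0, L⁻¹e_j), so by parts
it acts on g as i times that directional derivative. -/
theorem hasOsc_linear_mul {κ : Type*} [Fintype κ] (e : OrthonormalBasis κ ℝ V) {m : ℝ}
    (hm : 0 ≤ m) {g : V → ℂ} (hg : UniformSymbol m (fun _ : Unit => g)) (l : V →L[ℝ] ℂ) :
    HasOsc L (fun p => l p.1 * g p.2) (((2 * Real.pi) ^ Module.finrank ℝ V : ℝ) *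
      (Complex.I * ∑ j, l (e j) * fderiv ℝ g 0 (L.symm (e j)))) := by
  have hg2 := hg.comp_snd hm
  have h1 : ∀ j, HasOsc L (fun p => ((inner ℝ (e j) p.1 : ℝ) : ℂ) * g p.2)
      (Complex.I * (((2 * Real.pi) ^ Module.finrank ℝ V : ℝ) *
        fderiv ℝ g 0 (L.symm (e j)))) := by
    intro j
    have h := HasOsc.fderiv_phase_mul (L := L) (v := (0, L.symm (e j))) hg2 (hasOsc_snd hm hg)
      (I := ((2 * Real.pi) ^ Module.finrank ℝ V : ℝ) * fderiv ℝ g 0 (L.symm (e j))) ?_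
    · simpa [fderiv_phase_apply, real_inner_comm] using h
    · have h2 := hasOsc_snd (L := L) hm (hg.fderiv_apply (L.symm (e j)))
      convert h2 using 2 with p
      have : HasFDerivAt (fun q : V × V => g q.2)
          ((fderiv ℝ g p.2).comp (ContinuousLinearMap.snd ℝ V V)) p :=
        ((hg.contDiff ()).differentiable (by simp) p.2).hasFDerivAt.comp p hasFDerivAt_snd
      rw [this.fderiv]
      simp
  have hs : ∀ j, UniformSymbol (m + 1) (fun (_ : Unit) (p : V × V) =>
      l (e j) * (((inner ℝ (e j) p.1 : ℝ) : ℂ) * g p.2)) := by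
    intro j
    have := ((UniformSymbol.linear (ι := Unit) (c := fun _ => (innerSL ℝ (e j)).comp
      (ContinuousLinearMap.fst ℝ V V)) ⟨_, fun _ => le_rfl⟩).smul hg2).clm
      (ContinuousLinearMap.mul ℝ ℂ (l (e j)))
    simpa [add_comm, Complex.real_smul] using this
  have h2 := HasOsc.sum Finset.univ (fun j _ => hs j) fun j _ => (h1 j).const_mul (l (e j))
  convert h2 using 1
  · funext p
    have := congrArg l (e.sum_repr' p.1)
    rw [← this, map_sum, Finset.sum_mul]
    refine Finset.sum_congr rfl fun j _ => ?_
    rw [map_smul, Complex.real_smul]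
    ring
  · rw [Finset.mul_sum, Finset.mul_sum]
    refine Finset.sum_congr rfl fun j _ => ?_
    ring

end Evaluation

/-! ### Second-order expansion with uniform remainder -/

section Expansion

variable {ι V F : Type*} [NormedAddCommGroup V] [NormedAddCommGroup F] [NormedSpace ℝ F]

/-- Pairs of a linear map of norm at most `K` and a scale in `(0, 1]`. -/
abbrev ScaledMap (V : Type*) [NormedAddCommGroup V] [NormedSpace ℝ V] (K : ℝ) : Type _ :=
  {q : (V →L[ℝ] V) × ℝ // ‖q.1‖ ≤ K ∧ 0 < q.2 ∧ q.2 ≤ 1}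

theorem ScaledMap.norm_smul_le [NormedSpace ℝ V] {K : ℝ} (q : ScaledMap V K) :
    ‖q.1.2 • q.1.1‖ ≤ K := by
  obtain ⟨⟨A, r⟩, hA, h0, h1⟩ := q
  rw [norm_smul, Real.norm_of_nonneg h0.le]
  exact (mul_le_of_le_one_left (norm_nonneg _) h1).trans hA

/-- First-order difference quotients at the origin. -/
theorem UniformSymbol.diffQuotient [NormedSpace ℝ V] {m : ℝ} (hm : 0 ≤ m) {f : V → F} {K : ℝ}
    (hf : UniformSymbol m (fun _ : Unit => f)) :
    UniformSymbol (m + 1) (fun (q : ScaledMap V K) X => q.1.2⁻¹ • (f ((q.1.2 • q.1.1) X) - f 0)) := by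
  -- The scale cancels on differentiation, leaving Df(rAX) ∘ A, of order m uniformly in A and r.
  have hd : ∀ (q : ScaledMap V K) X,
      HasFDerivAt (fun X => q.1.2⁻¹ • (f ((q.1.2 • q.1.1) X) - f 0))
        ((_root_.fderiv ℝ f ((q.1.2 • q.1.1) X)).comp q.1.1) X := by
    intro q X
    have h := (((((hf.contDiff ()).differentiable (by simp)
      ((q.1.2 • q.1.1) X)).hasFDerivAt.comp X (q.1.2 • q.1.1).hasFDerivAt).sub_const
      (f 0)).const_smul q.1.2⁻¹)
    convert! h using 1
    rw [ContinuousLinearMap.comp_smul, smul_smul, inv_mul_cancel₀ q.2.2.1.ne', one_smul]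
  refine of_fderiv_of_zero hm (fun q => ?_) (fun q => by simp) ?_
  · exact (((hf.contDiff ()).comp (q.1.2 • q.1.1).contDiff).sub contDiff_const).const_smul _
  · have h1 : UniformSymbol m (fun (q : ScaledMap V K) X =>
        _root_.fderiv ℝ f ((q.1.2 • q.1.1) X)) :=
      (hf.fderiv.comp_family fun _ => ()).comp_linear hm ⟨K, fun q => q.norm_smul_le⟩
    have h2 : UniformSymbol 0 (fun (q : ScaledMap V K) (_ : V) => q.1.1) :=
      of_bounded_const ⟨K, fun q => q.2.1⟩
    have h3 := (h1.bilinear (ContinuousLinearMap.compL ℝ V V F) h2).mono (add_zero m).le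
    refine h3.congr fun q => funext fun X => ?_
    rw [(hd q X).fderiv, ContinuousLinearMap.compL_apply]

/-- Second-order Taylor remainders at the origin. -/
theorem UniformSymbol.taylorRemainder [NormedSpace ℝ V] {m : ℝ} (hm : 0 ≤ m) {f : V → F} {K : ℝ}
    (hf : UniformSymbol m (fun _ : Unit => f)) :
    UniformSymbol (m + 2) (fun (q : ScaledMap V K) X => (q.1.2 ^ 2)⁻¹ •
      (f ((q.1.2 • q.1.1) X) - f 0 - _root_.fderiv ℝ f 0 ((q.1.2 • q.1.1) X))) := by
  -- The derivative is the first-order difference quotient of Df composed with A, so the previous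
  -- lemma applies to Df.
  have hd : ∀ (q : ScaledMap V K) X,
      HasFDerivAt (fun X => (q.1.2 ^ 2)⁻¹ •
        (f ((q.1.2 • q.1.1) X) - f 0 - _root_.fderiv ℝ f 0 ((q.1.2 • q.1.1) X)))
        ((q.1.2⁻¹ • (_root_.fderiv ℝ f ((q.1.2 • q.1.1) X) - _root_.fderiv ℝ f 0)).comp q.1.1)
        X := by
    intro q X
    have h := ((((((hf.contDiff ()).differentiable (by simp)
      ((q.1.2 • q.1.1) X)).hasFDerivAt.comp X (q.1.2 • q.1.1).hasFDerivAt).sub_const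
      (f 0)).sub ((_root_.fderiv ℝ f 0).hasFDerivAt.comp X
        (q.1.2 • q.1.1).hasFDerivAt)).const_smul (q.1.2 ^ 2)⁻¹)
    convert! h using 1
    have h0 := q.2.2.1.ne'
    rw [ContinuousLinearMap.comp_smul, ContinuousLinearMap.comp_smul, ← smul_sub, smul_smul,
      ← ContinuousLinearMap.sub_comp, ContinuousLinearMap.smul_comp]
    congr 1
    field_simp
  rw [show m + 2 = m + 1 + 1 by ring]
  refine of_fderiv_of_zero (by linarith) (fun q => ?_) (fun q => by simp) ?_
  · exact ((((hf.contDiff ()).comp (q.1.2 • q.1.1).contDiff).sub contDiff_const).sub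
      ((_root_.fderiv ℝ f 0).contDiff.comp (q.1.2 • q.1.1).contDiff)).const_smul _
  · have h1 := hf.fderiv.diffQuotient hm (K := K)
    have h2 : UniformSymbol 0 (fun (q : ScaledMap V K) (_ : V) => q.1.1) :=
      of_bounded_const ⟨K, fun q => q.2.1⟩
    have h3 := (h1.bilinear (ContinuousLinearMap.compL ℝ V V F) h2).mono (add_zero (m + 1)).le
    refine h3.congr fun q => funext fun X => ?_
    rw [(hd q X).fderiv, ContinuousLinearMap.compL_apply]

variable [InnerProductSpace ℝ V] [FiniteDimensional ℝ V] [MeasurableSpace V] [BorelSpace V]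
  {L : V ≃ₗᵢ[ℝ] V}

theorem exists_hasOsc_mul {κ : Type*} [Fintype κ] (e : OrthonormalBasis κ ℝ V) {m : ℝ}
    (hm : 0 ≤ m) {f g : V → ℂ} (hf : UniformSymbol m (fun _ : Unit => f))
    (hg : UniformSymbol m (fun _ : Unit => g)) (K : ℝ) :
    ∃ C, ∀ A : V →L[ℝ] V, ∃ I, HasOsc L (fun p => f (A p.1) * g p.2)
        (((2 * Real.pi) ^ Module.finrank ℝ V : ℝ) * I) ∧
      ∀ r : ℝ, 0 ≤ r → r ≤ 1 → ‖A‖ ≤ K * r →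
        ‖I - (f 0 * g 0 + Complex.I * ∑ j, fderiv ℝ f 0 (A (e j)) *
          fderiv ℝ g 0 (L.symm (e j)))‖ ≤ C * r ^ 2 := by
  have hN : (((2 * Real.pi) ^ Module.finrank ℝ V : ℝ) : ℂ) ≠ 0 := by
    exact_mod_cast (by positivity : ((2 * Real.pi) ^ Module.finrank ℝ V : ℝ) ≠ 0)
  set N : ℂ := (((2 * Real.pi) ^ Module.finrank ℝ V : ℝ) : ℂ)
  have hg2 := hg.comp_snd hm
  have hR := ((hf.taylorRemainder hm (K := K)).comp_fst (by linarith)).mul (hg2.comp_family fun _ => ())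
  obtain ⟨B, hB⟩ := hR.exists_hasOsc (L := L)
  -- Existence needs no smallness of A. The value is fixed before r, so that it serves every
  -- admissible r.
  have hex : ∀ A : V →L[ℝ] V, ∃ I, HasOsc L (fun p => f (A p.1) * g p.2) (N * I) := by
    intro A
    have h1 : UniformSymbol m (fun (_ : Unit) (p : V × V) => f (A p.1)) :=
      hf.comp_linear hm (A := fun _ => A.comp (ContinuousLinearMap.fst ℝ V V))
        ⟨_, fun _ => le_rfl⟩
    obtain ⟨_, h⟩ := (h1.mul hg2).exists_hasOsc (L := L)
    obtain ⟨I, hI, -⟩ := h ()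
    exact ⟨N⁻¹ * I, by rwa [mul_inv_cancel_left₀ hN]⟩
  choose I hI using hex
  refine ⟨‖N⁻¹‖ * max B 0, fun A => ⟨I A, hI A, fun r hr0 hr1 hAr => ?_⟩⟩
  have hB0 : 0 ≤ max B 0 := le_max_right _ _
  have h0 : HasOsc L (fun p => f 0 * g p.2) (f 0 * (N * g 0)) := (hasOsc_snd hm hg).const_mul _
  -- The rescaled remainder is only available for r > 0; at r = 0 the map A vanishes and the
  -- integrand is f(0) g(Y).
  rcases hr0.eq_or_lt with h | hr0
  · have hA : A = 0 := by simpa [← h] using hAr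
    have hI0 := hI A
    subst hA
    simp only [zero_apply] at hI0
    have h2 := h0.unique hI0
    have h3 : I 0 = f 0 * g 0 := mul_left_cancel₀ hN (by rw [← h2]; ring)
    rw [h3]
    simp
    positivity
  · have hrA : r • (r⁻¹ • A) = A := smul_inv_smul₀ hr0.ne' A
    have hA1 : ‖r⁻¹ • A‖ ≤ K := by
      rw [norm_smul, norm_inv, Real.norm_of_nonneg hr0.le]
      rwa [inv_mul_le_iff₀ hr0, mul_comm]
    obtain ⟨J, hJ, hJB⟩ := hB ⟨(r⁻¹ • A, r), hA1, hr0, hr1⟩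
    have hRq := hR.comp_family (fun _ : Unit => (⟨(r⁻¹ • A, r), hA1, hr0, hr1⟩ : ScaledMap V K))
    simp only [hrA] at hJ hRq
    have hlin := hasOsc_linear_mul (L := L) e hm hg ((fderiv ℝ f 0).comp A)
    have hlinS : UniformSymbol (1 + m) (fun (_ : Unit) (p : V × V) =>
        ((fderiv ℝ f 0).comp A) p.1 * g p.2) :=
      (UniformSymbol.linear (ι := Unit) (c := fun _ => ((fderiv ℝ f 0).comp A).comp
        (ContinuousLinearMap.fst ℝ V V)) ⟨_, fun _ => le_rfl⟩).mul hg2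
    have h0S : UniformSymbol m (fun (_ : Unit) (p : V × V) => f 0 * g p.2) :=
      hg2.clm (ContinuousLinearMap.mul ℝ ℂ (f 0))
    have hRS : UniformSymbol (m + 2 + m) (fun (_ : Unit) (p : V × V) => ((r ^ 2 : ℝ) : ℂ) *
        (((r ^ 2)⁻¹ • (f (A p.1) - f 0 - fderiv ℝ f 0 (A p.1))) * g p.2)) :=
      hRq.clm (ContinuousLinearMap.mul ℝ ℂ ((r ^ 2 : ℝ) : ℂ))
    have hsum := HasOsc.add (m := m + 2 + m)
      ((h0S.mono (by linarith)).add (hlinS.mono (by linarith))) hRS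
      (HasOsc.add (m := m + 2 + m) (h0S.mono (by linarith)) (hlinS.mono (by linarith)) h0 hlin)
      (hJ.const_mul _)
    have hfun : (fun p : V × V => f 0 * g p.2 + ((fderiv ℝ f 0).comp A) p.1 * g p.2 +
        ((r ^ 2 : ℝ) : ℂ) *
        (((r ^ 2)⁻¹ • (f (A p.1) - f 0 - fderiv ℝ f 0 (A p.1))) * g p.2)) =
        fun p => f (A p.1) * g p.2 := by
      funext p
      have : (r : ℂ) ≠ 0 := by exact_mod_cast hr0.ne'
      simp only [ContinuousLinearMap.comp_apply, Complex.real_smul]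
      push_cast
      field_simp
      ring
    rw [hfun] at hsum
    have hval := (hI A).unique hsum
    have hdiff : I A - (f 0 * g 0 + Complex.I * ∑ j, fderiv ℝ f 0 (A (e j)) *
          fderiv ℝ g 0 (L.symm (e j))) = N⁻¹ * (((r ^ 2 : ℝ) : ℂ) * J) := by
      rw [eq_inv_mul_iff_mul_eq₀ hN, mul_sub, hval]
      simp only [ContinuousLinearMap.comp_apply]
      ring
    rw [hdiff, norm_mul, norm_mul, Complex.norm_real, Real.norm_of_nonneg (by positivity)]
    calc ‖N⁻¹‖ * (r ^ 2 * ‖J‖) ≤ ‖N⁻¹‖ * (r ^ 2 * max B 0) := by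
          gcongr
          exact hJB.trans (le_max_left _ _)
      _ = _ := by ring

end Expansion

/-! ### Deformed product and commutator on Minkowski space -/

section DeformedProduct

variable {d : ℕ}

/-- Lowering an index as a linear isometry. -/
noncomputable def lowerEquiv (d : ℕ) : Emb d ≃ₗᵢ[ℝ] Emb d :=
  LinearIsometryEquiv.piLpCongrRight 2 fun μ =>
    if μ = 0 then LinearIsometryEquiv.neg ℝ else LinearIsometryEquiv.refl ℝ ℝ

theorem lowerEquiv_apply (X : Emb d) : lowerEquiv d X = lowerIndex X := by
  ext μ
  by_cases h : μ = 0 <;> simp [lowerEquiv, lowerIndex, h]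

theorem lowerEquiv_symm_apply (X : Emb d) : (lowerEquiv d).symm X = lowerIndex X := by
  rw [LinearIsometryEquiv.symm_apply_eq, lowerEquiv_apply]
  ext μ
  by_cases h : μ = 0 <;> simp [lowerIndex, h]

theorem phase_lowerEquiv (p : Emb d × Emb d) : phase (lowerEquiv d) p = mink p.1 p.2 := by
  simp [phase, lowerEquiv_apply, mink, PiLp.inner_apply, Fin.sum_univ_succ, lowerIndex,
    Fin.succ_ne_zero, mul_comm]

/-- `X ↦ Θ X` as a continuous linear map. -/
noncomputable def thetaMap (Θ : Matrix (Fin (d + 1)) (Fin (d + 1)) ℝ) : Emb d →L[ℝ] Emb d :=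
  (Matrix.toEuclideanCLM (n := Fin (d + 1)) (𝕜 := ℝ) Θ).comp (lowerEquiv d : Emb d →L[ℝ] Emb d)

theorem thetaMap_apply (Θ : Matrix (Fin (d + 1)) (Fin (d + 1)) ℝ) (X : Emb d) :
    thetaMap Θ X = thetaAct Θ X := by
  ext μ
  simp [thetaMap, thetaAct, lowerEquiv_apply, Matrix.ofLp_toEuclideanCLM, Matrix.mulVec,
    dotProduct]

/-- Converts entrywise size into operator norm. The crude factor (d + 1)² is the triangle inequality
over rows and columns. -/
theorem norm_thetaMap_le {Θ : Matrix (Fin (d + 1)) (Fin (d + 1)) ℝ} {r : ℝ}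
    (h : ∀ μ ν, |Θ μ ν| ≤ r) : ‖thetaMap Θ‖ ≤ (d + 1) ^ 2 * r := by
  have hr : 0 ≤ r := (abs_nonneg _).trans (h 0 0)
  refine ContinuousLinearMap.opNorm_le_bound _ (by positivity) fun X => ?_
  rw [thetaMap_apply]
  have hl : ∀ ν, |lowerIndex X ν| ≤ ‖X‖ := fun ν => by
    rw [← lowerEquiv_apply, ← (lowerEquiv d).norm_map X]
    exact PiLp.norm_apply_le (lowerEquiv d X) ν
  have hc : ∀ μ, ‖thetaAct Θ X μ‖ ≤ (d + 1) * (r * ‖X‖) := fun μ => by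
    have hs : ∑ _ν : Fin (d + 1), r * ‖X‖ = (d + 1) * (r * ‖X‖) := by simp
    rw [← hs]
    change ‖∑ ν, Θ μ ν * lowerIndex X ν‖ ≤ _
    refine (norm_sum_le _ _).trans (Finset.sum_le_sum fun ν _ => ?_)
    rw [Real.norm_eq_abs, abs_mul]
    exact mul_le_mul (h μ ν) (hl ν) (abs_nonneg _) hr
  calc ‖thetaAct Θ X‖ = ‖∑ μ, EuclideanSpace.single μ (thetaAct Θ X μ)‖ := by
        congr 1
        ext ν
        simp [Finset.sum_apply]
    _ ≤ ∑ μ, ‖thetaAct Θ X μ‖ := (norm_sum_le _ _).trans (by simp)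
    _ ≤ ∑ _μ : Fin (d + 1), (d + 1) * (r * ‖X‖) := Finset.sum_le_sum fun μ _ => hc μ
    _ = (d + 1) ^ 2 * r * ‖X‖ := by simp; ring

/-- Moves the base point to the origin, at the cost of 1 + ‖Z + p‖ ≤ (1 + ‖Z‖)(1 + ‖p‖). -/
theorem Admissible.uniformSymbol_translate {f : Emb d → ℂ} (hf : Admissible f) (Z : Emb d) :
    ∃ m : ℕ, UniformSymbol (m : ℝ) (fun (_ : Unit) X => f (Z + X)) := by
  obtain ⟨hs, m, hm⟩ := hf
  refine ⟨m, fun _ => hs.comp (contDiff_const.add contDiff_id), fun k => ?_⟩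
  obtain ⟨C, hC⟩ := hm k
  refine ⟨max C 0 * (1 + ‖Z‖) ^ m, fun _ p => ?_⟩
  rw [iteratedFDeriv_comp_add_left, Real.rpow_natCast]
  calc ‖iteratedFDeriv ℝ k f (Z + p)‖ ≤ C * (1 + ‖Z + p‖) ^ m := hC _
    _ ≤ max C 0 * ((1 + ‖Z‖) * (1 + ‖p‖)) ^ m := by
      gcongr
      · exact le_max_left _ _
      · nlinarith [norm_add_le Z p, norm_nonneg Z, norm_nonneg p]
    _ = _ := by rw [mul_pow, mul_assoc]

/-- The Poisson bracket `Θ^{μν} ∂_μ f ∂_ν g` at `Z`. -/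
noncomputable def poisson (Θ : Matrix (Fin (d + 1)) (Fin (d + 1)) ℝ) (f g : Emb d → ℂ)
    (Z : Emb d) : ℂ :=
  ∑ μ, ∑ ν, (Θ μ ν : ℂ) * fderiv ℝ f Z (EuclideanSpace.single μ 1) *
    fderiv ℝ g Z (EuclideanSpace.single ν 1)

theorem poisson_swap {Θ : Matrix (Fin (d + 1)) (Fin (d + 1)) ℝ} (hΘ : Θ.transpose = -Θ)
    (f g : Emb d → ℂ) (Z : Emb d) : poisson Θ g f Z = -poisson Θ f g Z := by
  rw [poisson, poisson, Finset.sum_comm, ← Finset.sum_neg_distrib]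
  refine Finset.sum_congr rfl fun μ _ => ?_
  rw [← Finset.sum_neg_distrib]
  refine Finset.sum_congr rfl fun ν _ => ?_
  have : Θ ν μ = -Θ μ ν := congrFun (congrFun hΘ μ) ν
  rw [this]
  push_cast
  ring

/-- The metric enters twice, through Θ acting on lowered indices and through L⁻¹; on each basis
vector the two signs cancel. -/
theorem sum_fderiv_thetaMap (Θ : Matrix (Fin (d + 1)) (Fin (d + 1)) ℝ) (f g : Emb d → ℂ)
    (Z : Emb d) :
    ∑ ν, fderiv ℝ f Z (thetaMap Θ (EuclideanSpace.basisFun (Fin (d + 1)) ℝ ν)) *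
      fderiv ℝ g Z ((lowerEquiv d).symm (EuclideanSpace.basisFun (Fin (d + 1)) ℝ ν)) =
      poisson Θ f g Z := by
  rw [poisson, Finset.sum_comm]
  refine Finset.sum_congr rfl fun ν _ => ?_
  obtain ⟨σ, hσ, hl⟩ : ∃ σ : ℝ, σ * σ = 1 ∧
      lowerIndex (EuclideanSpace.single ν (1 : ℝ) : Emb d) = σ • EuclideanSpace.single ν 1 := by
    refine ⟨if ν = 0 then -1 else 1, by split_ifs <;> norm_num, ?_⟩
    ext μ
    by_cases h : μ = ν
    · subst h
      by_cases h : μ = 0 <;> simp [lowerIndex, h]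
    · rw [PiLp.smul_apply]
      simp [lowerIndex, h]
  have hθ : thetaMap Θ (EuclideanSpace.single ν (1 : ℝ) : Emb d) =
      σ • ∑ μ, Θ μ ν • EuclideanSpace.single μ (1 : ℝ) := by
    ext μ
    rw [thetaMap_apply]
    simp [thetaAct, hl, Pi.single_apply, mul_comm]
  have hσ' : (σ : ℂ) * σ = 1 := by exact_mod_cast hσ
  rw [EuclideanSpace.basisFun_apply, lowerEquiv_symm_apply, hl, hθ]
  simp only [map_smul, map_sum, Complex.real_smul]
  rw [← Finset.sum_mul, mul_mul_mul_comm, hσ', one_mul]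

theorem HasOsc.hasDeformedProduct {Θ : Matrix (Fin (d + 1)) (Fin (d + 1)) ℝ} {f g : Emb d → ℂ}
    {Z : Emb d} {w : ℂ}
    (h : HasOsc (lowerEquiv d) (fun p => f (Z + thetaMap Θ p.1) * g (Z + p.2))
      (((2 * Real.pi) ^ Module.finrank ℝ (Emb d) : ℝ) * w)) :
    HasDeformedProduct Θ f g Z w := by
  intro χ hχ
  have hN : (((2 * Real.pi) ^ (d + 1) : ℝ) : ℂ) ≠ 0 := by
    exact_mod_cast (by positivity : ((2 * Real.pi) ^ (d + 1) : ℝ) ≠ 0)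
  have h1 := (h χ).const_mul (((2 * Real.pi) ^ (d + 1) : ℝ) : ℂ)⁻¹
  rw [hχ, one_mul, finrank_euclideanSpace_fin, inv_mul_cancel_left₀ hN] at h1
  refine h1.congr fun ε => ?_
  rw [regProduct]
  congr 2 with p
  simp only [osc, phase_lowerEquiv, thetaMap_apply]
  ring

theorem Admissible.exists_hasDeformedProduct {f g : Emb d → ℂ} (hf : Admissible f)
    (hg : Admissible g) (Z : Emb d) (K : ℝ) :
    ∃ C, ∀ Θ : Matrix (Fin (d + 1)) (Fin (d + 1)) ℝ, ∃ w, HasDeformedProduct Θ f g Z w ∧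
      ∀ r : ℝ, 0 ≤ r → r ≤ 1 → ‖thetaMap Θ‖ ≤ K * r →
        ‖w - (f Z * g Z + Complex.I * poisson Θ f g Z)‖ ≤ C * r ^ 2 := by
  obtain ⟨m, hm⟩ := hf.uniformSymbol_translate Z
  obtain ⟨m', hm'⟩ := hg.uniformSymbol_translate Z
  obtain ⟨C, hC⟩ := exists_hasOsc_mul (L := lowerEquiv d) (EuclideanSpace.basisFun (Fin (d + 1)) ℝ)
    (m := max m m') (by positivity) (hm.mono (le_max_left _ _)) (hm'.mono (le_max_right _ _)) K
  refine ⟨C, fun Θ => ?_⟩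
  obtain ⟨w, hw, hwC⟩ := hC (thetaMap Θ)
  refine ⟨w, hw.hasDeformedProduct, fun r hr0 hr1 h => ?_⟩
  have := hwC r hr0 hr1 h
  simpa only [fderiv_comp_add_left, add_zero, sum_fderiv_thetaMap] using this

/-- The deformed commutator of admissible functions is `2i Θ^{μν} ∂_μ f ∂_ν g + O(Θ²)`. -/
theorem Admissible.commutatorExpansion {f g : Emb d → ℂ} (hf : Admissible f) (hg : Admissible g)
    (Z : Emb d) :
    CommutatorExpansion f g Z (fun Θ => 2 * Complex.I * poisson Θ f g Z) := by
  obtain ⟨C, hC⟩ := hf.exists_hasDeformedProduct hg Z ((d + 1) ^ 2)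
  obtain ⟨C', hC'⟩ := hg.exists_hasDeformedProduct hf Z ((d + 1) ^ 2)
  choose p hp hpC using hC
  choose q hq hqC using hC'
  refine ⟨C + C', fun Θ hΘ => ⟨p Θ - q Θ, ⟨p Θ, q Θ, hp Θ, hq Θ, rfl⟩, fun r hr1 hr => ?_⟩⟩
  have hr0 : 0 ≤ r := (abs_nonneg _).trans (hr 0 0)
  have h1 := hpC Θ r hr0 hr1 (norm_thetaMap_le hr)
  have h2 := hqC Θ r hr0 hr1 (norm_thetaMap_le hr)
  -- After the sign change the brackets add up in the difference, while the products fg and gf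
  -- cancel.
  rw [poisson_swap hΘ] at h2
  rw [add_mul]
  refine le_trans (le_of_eq ?_) ((norm_sub_le _ _).trans (add_le_add h1 h2))
  congr 1
  ring

end DeformedProduct

/-! ### Representatives of the coordinates and their differentials -/

section Representatives

variable {d : ℕ}

/-- A bump equal to 1 near Z and supported in U multiplies φ. Compact support bounds every
derivative, so the growth exponent is 0. -/
theorem exists_admissible_eventuallyEq {φ : Emb d → ℂ} {U : Set (Emb d)} (hU : IsOpen U)
    (hφ : ∀ X ∈ U, ContDiffAt ℝ ∞ φ X) {Z : Emb d} (hZ : Z ∈ U) :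
    ∃ f, Admissible f ∧ f =ᶠ[𝓝 Z] φ := by
  obtain ⟨ε, hε, hball⟩ := Metric.isOpen_iff.mp hU Z hZ
  let β : ContDiffBump Z := ⟨ε / 4, ε / 2, by positivity, by linarith⟩
  have hβs : HasCompactSupport (fun X => ((β X : ℝ) : ℂ)) :=
    β.hasCompactSupport.comp_left (g := fun r : ℝ => (r : ℂ)) Complex.ofReal_zero
  have hcomp : HasCompactSupport (fun X => ((β X : ℝ) : ℂ) * φ X) := hβs.mul_right
  have hsupp : tsupport (fun X => ((β X : ℝ) : ℂ) * φ X) ⊆ U := by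
    refine (tsupport_mul_subset_left (f := fun X => ((β X : ℝ) : ℂ)) (g := φ)).trans ?_
    refine (closure_mono (Function.support_comp_subset Complex.ofReal_zero β)).trans ?_
    refine (β.tsupport_eq.le.trans ?_)
    exact (Metric.closedBall_subset_ball (by change ε / 2 < ε; linarith)).trans hball
  have hd : ContDiff ℝ ∞ (fun X => ((β X : ℝ) : ℂ) * φ X) :=
    contDiff_iff_contDiffAt.mpr fun X => by
      by_cases hX : X ∈ tsupport (fun X => ((β X : ℝ) : ℂ) * φ X)
      · exact (Complex.ofRealCLM.contDiff.comp β.contDiff).contDiffAt.mul (hφ X (hsupp hX))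
      · exact contDiffAt_const.congr_of_eventuallyEq (notMem_tsupport_iff_eventuallyEq.mp hX)
  refine ⟨fun X => ((β X : ℝ) : ℂ) * φ X, ⟨hd, 0, fun k => ?_⟩, ?_⟩
  · obtain ⟨C, hC⟩ := (hcomp.iteratedFDeriv k).exists_bound_of_continuous
      (hd.continuous_iteratedFDeriv (m := k) (by exact_mod_cast le_top))
    exact ⟨C, fun X => by simpa using hC X⟩
  · filter_upwards [β.eventuallyEq_one] with X hX
    simp [hX]

/-- The radicand of `lastOf`. -/
noncomputable def radicand (H : ℝ) (X : Emb d) : ℝ := (H ^ 2)⁻¹ + X 0 ^ 2 - ∑ a : Fin d, X a.succ ^ 2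

theorem contDiff_radicand (H : ℝ) : ContDiff ℝ ∞ (radicand (d := d) H) := by
  unfold radicand
  fun_prop

/-- The region where the extensions of the coordinates are smooth. -/
def patch (d : ℕ) (H : ℝ) : Set (Emb d) := {X | 0 < radicand H X ∧ 0 < X 0 + lastOf H X}

theorem isOpen_patch (H : ℝ) : IsOpen (patch d H) := by
  have h1 : Continuous (radicand (d := d) H) := (contDiff_radicand H).continuous
  have h2 : Continuous (fun X : Emb d => X 0 + lastOf H X) :=
    (by fun_prop : Continuous fun X : Emb d => X 0).add h1.sqrt
  exact (isOpen_lt continuous_const h1).inter (isOpen_lt continuous_const h2)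

variable {H : ℝ}

theorem contDiffAt_lastOf {X : Emb d} (hX : X ∈ patch d H) : ContDiffAt ℝ ∞ (lastOf H) X :=
  (contDiff_radicand H).contDiffAt.sqrt hX.1.ne'

theorem contDiffAt_timeOf (hH : 0 < H) {X : Emb d} (hX : X ∈ patch d H) :
    ContDiffAt ℝ ∞ (timeOf H) X := by
  have h0 : ContDiffAt ℝ ∞ (fun X : Emb d => X 0) X := by fun_prop
  exact contDiffAt_const.mul ((contDiffAt_const.mul (h0.add (contDiffAt_lastOf hX))).log
    (mul_pos hH hX.2).ne')

theorem contDiffAt_spaceOf (hH : 0 < H) {X : Emb d} (hX : X ∈ patch d H) (b : Fin d) :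
    ContDiffAt ℝ ∞ (fun X => spaceOf H X b) X := by
  have h0 : ContDiffAt ℝ ∞ (fun X : Emb d => X 0) X := by fun_prop
  have hb : ContDiffAt ℝ ∞ (fun X : Emb d => X b.succ) X := by fun_prop
  exact hb.div (contDiffAt_const.mul (h0.add (contDiffAt_lastOf hX))) (mul_pos hH hX.2).ne'

variable {t : ℝ} {x : Fin d → ℝ}

theorem embPoint_zero_add_embLast (H t : ℝ) (x : Fin d → ℝ) :
    embPoint H t x 0 + embLast H t x = Real.exp (H * t) / H := by
  simp only [embPoint, embLast, Fin.cons_zero]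
  rw [← Real.cosh_add_sinh]
  ring

theorem embPoint_succ (H t : ℝ) (x : Fin d → ℝ) (a : Fin d) :
    embPoint H t x a.succ = Real.exp (H * t) * x a := by
  simp [embPoint]

/-- This is the hyperboloid equation, obtained by factoring (X^n)² - (X^0)² as (X^n - X^0)(X^n +
X^0). -/
theorem radicand_embPoint (hH : 0 < H) (t : ℝ) (x : Fin d → ℝ) :
    radicand H (embPoint H t x) = embLast H t x ^ 2 := by
  have h1 : embLast H t x - embPoint H t x 0 =
      Real.exp (-(H * t)) / H - H * Real.exp (H * t) * sqSum x := by
    simp only [embPoint, embLast, Fin.cons_zero]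
    rw [← Real.cosh_sub_sinh]
    ring
  have h2 := embPoint_zero_add_embLast H t x
  have h3 : ∑ a : Fin d, embPoint H t x a.succ ^ 2 = Real.exp (H * t) ^ 2 * sqSum x := by
    simp only [embPoint_succ, mul_pow, sqSum, Finset.mul_sum]
  have h4 : Real.exp (-(H * t)) * Real.exp (H * t) = 1 := by rw [← Real.exp_add]; simp
  have h5 : embLast H t x ^ 2 - embPoint H t x 0 ^ 2 =
      (H ^ 2)⁻¹ - Real.exp (H * t) ^ 2 * sqSum x := by
    calc _ = (embLast H t x - embPoint H t x 0) * (embPoint H t x 0 + embLast H t x) := by ring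
      _ = (Real.exp (-(H * t)) * Real.exp (H * t)) * (H ^ 2)⁻¹ -
          (H * H⁻¹) * Real.exp (H * t) ^ 2 * sqSum x := by
        rw [h1, h2]
        field_simp
      _ = _ := by rw [h4, mul_inv_cancel₀ hH.ne']; ring
  rw [radicand, h3]
  linarith

theorem lastOf_embPoint (hH : 0 < H) (hpos : 0 < embLast H t x) :
    lastOf H (embPoint H t x) = embLast H t x := by
  change √(radicand H (embPoint H t x)) = _
  rw [radicand_embPoint hH, Real.sqrt_sq hpos.le]

theorem embPoint_mem_patch (hH : 0 < H) (hpos : 0 < embLast H t x) :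
    embPoint H t x ∈ patch d H := by
  refine ⟨?_, ?_⟩
  · rw [radicand_embPoint hH]
    positivity
  · rw [lastOf_embPoint hH hpos, embPoint_zero_add_embLast]
    positivity

theorem exists_represents_coordT (hH : 0 < H) (hpos : 0 < embLast H t x) :
    ∃ f, Represents H t x coordT f :=
  exists_admissible_eventuallyEq (isOpen_patch H)
    (fun _ hX => Complex.ofRealCLM.contDiff.contDiffAt.comp _ (contDiffAt_timeOf hH hX))
    (embPoint_mem_patch hH hpos)

theorem exists_represents_coordX (hH : 0 < H) (hpos : 0 < embLast H t x) (b : Fin d) :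
    ∃ f, Represents H t x (coordX b) f :=
  exists_admissible_eventuallyEq (isOpen_patch H)
    (fun _ hX => Complex.ofRealCLM.contDiff.contDiffAt.comp _ (contDiffAt_spaceOf hH hX b))
    (embPoint_mem_patch hH hpos)

/-- `δ^0_μ - F_μ`. -/
noncomputable def covector (H t : ℝ) (x : Fin d → ℝ) : Fin (d + 1) → ℝ :=
  Pi.single 0 1 - (lowerIndex (Fvec H t x)).ofLp

/-- The covector with the given components, as a linear form. -/
noncomputable def covectorForm (u : Fin (d + 1) → ℝ) : Emb d →L[ℝ] ℝ :=
  ∑ μ, u μ • EuclideanSpace.proj μ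

theorem covectorForm_single (u : Fin (d + 1) → ℝ) (ν : Fin (d + 1)) :
    covectorForm u (EuclideanSpace.single ν 1) = u ν := by
  simp [covectorForm]

/-- Differentiating the square root gives dX^n = -F_μ dX^μ, because the radicand is H⁻² - X·X and
the root equals X^n at the point. -/
theorem hasFDerivAt_zero_add_lastOf (hH : 0 < H) (hpos : 0 < embLast H t x) :
    HasFDerivAt (fun X : Emb d => X 0 + lastOf H X) (covectorForm (covector H t x))
      (embPoint H t x) := by
  have hp : ∀ μ, HasFDerivAt (fun X : Emb d => X μ) (EuclideanSpace.proj μ : Emb d →L[ℝ] ℝ)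
      (embPoint H t x) := fun μ => (EuclideanSpace.proj μ : Emb d →L[ℝ] ℝ).hasFDerivAt
  have hq : HasFDerivAt (radicand H) _ (embPoint H t x) := (((hp 0).pow 2).const_add (H ^ 2)⁻¹).sub
    (HasFDerivAt.fun_sum (u := Finset.univ) fun (a : Fin d) _ => (hp a.succ).pow 2)
  have hr := (hp 0).add (hq.sqrt (embPoint_mem_patch hH hpos).1.ne')
  convert! hr using 1
  have h0 := hpos.ne'
  rw [radicand_embPoint hH, Real.sqrt_sq hpos.le]
  ext X
  simp only [covectorForm, covector, lowerIndex, Fvec, Fin.sum_univ_succ, add_apply, smul_apply,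
    sub_apply, sum_apply, PiLp.proj_apply, Pi.sub_apply, smul_eq_mul, nsmul_eq_mul]
  simp only [Fin.succ_ne_zero, Pi.single_eq_same, if_true, if_false,
    Pi.single_eq_of_ne (Fin.succ_ne_zero _)]
  rw [mul_sub, Finset.mul_sum, add_sub, sub_eq_add_neg _ (Finset.sum _ _), ← Finset.sum_neg_distrib]
  congr 1
  · field_simp
    norm_num
    ring
  · refine Finset.sum_congr rfl fun a _ => ?_
    field_simp
    norm_num
    ring

theorem fderiv_of_represents_coordT (hH : 0 < H) (hpos : 0 < embLast H t x) {f : Emb d → ℂ}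
    (hf : Represents H t x coordT f) (μ : Fin (d + 1)) :
    fderiv ℝ f (embPoint H t x) (EuclideanSpace.single μ 1) =
      ((Real.exp (-(H * t)) * covector H t x μ : ℝ) : ℂ) := by
  have hval : H * (embPoint H t x 0 + lastOf H (embPoint H t x)) = Real.exp (H * t) := by
    rw [lastOf_embPoint hH hpos, embPoint_zero_add_embLast]
    field_simp
  have h := (((hasFDerivAt_zero_add_lastOf hH hpos).const_mul H).log
    (by rw [hval]; positivity)).const_mul (1 / H)
  have h2 : HasFDerivAt (extension H coordT) _ (embPoint H t x) :=
    Complex.ofRealCLM.hasFDerivAt.comp (embPoint H t x) h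
  rw [hf.2.fderiv_eq, h2.fderiv]
  simp only [ContinuousLinearMap.comp_apply, smul_apply, covectorForm_single,
    hval, Complex.ofRealCLM_apply, smul_eq_mul, Real.exp_neg]
  congr 1
  field_simp

/-- Quotient rule for x^b = X^b/(Hu): the denominator is e^{Ht} and X^b = e^{Ht}x^b, so a single
e^{-Ht} factors out. -/
theorem fderiv_of_represents_coordX (hH : 0 < H) (hpos : 0 < embLast H t x) {b : Fin d}
    {f : Emb d → ℂ} (hf : Represents H t x (coordX b) f) (μ : Fin (d + 1)) :
    fderiv ℝ f (embPoint H t x) (EuclideanSpace.single μ 1) =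
      ((Real.exp (-(H * t)) * ((Pi.single b.succ 1 : Fin (d + 1) → ℝ) -
        (H * x b) • covector H t x) μ : ℝ) : ℂ) := by
  have hval : H * (embPoint H t x 0 + lastOf H (embPoint H t x)) = Real.exp (H * t) := by
    rw [lastOf_embPoint hH hpos, embPoint_zero_add_embLast]
    field_simp
  have hb : HasFDerivAt (fun X : Emb d => X b.succ) (EuclideanSpace.proj b.succ : Emb d →L[ℝ] ℝ)
      (embPoint H t x) := (EuclideanSpace.proj b.succ : Emb d →L[ℝ] ℝ).hasFDerivAt
  have hne : H * (embPoint H t x 0 + lastOf H (embPoint H t x)) ≠ 0 := by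
    rw [hval]
    positivity
  have h := hb.mul ((hasDerivAt_inv hne).comp_hasFDerivAt (embPoint H t x)
    ((hasFDerivAt_zero_add_lastOf hH hpos).const_mul H))
  have h2 : HasFDerivAt (extension H (coordX b)) _ (embPoint H t x) :=
    Complex.ofRealCLM.hasFDerivAt.comp (embPoint H t x) h
  rw [hf.2.fderiv_eq, h2.fderiv]
  simp only [ContinuousLinearMap.comp_apply, smul_apply, covectorForm_single,
    add_apply, Function.comp_apply, hval, Complex.ofRealCLM_apply, smul_eq_mul, Real.exp_neg,
    embPoint_succ, Pi.sub_apply, Pi.smul_apply]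
  congr 1
  have h1 : (EuclideanSpace.proj b.succ : Emb d →L[ℝ] ℝ) (EuclideanSpace.single μ 1) =
      (Pi.single b.succ 1 : Fin (d + 1) → ℝ) μ := by
    simp [Pi.single_apply, eq_comm]
  rw [h1]
  field_simp
  ring

/-! ### Poisson brackets of the coordinates -/

open Matrix in
theorem poisson_of_real {Θ : Matrix (Fin (d + 1)) (Fin (d + 1)) ℝ} {f g : Emb d → ℂ} {Z : Emb d}
    {c : ℝ} {u w : Fin (d + 1) → ℝ}
    (hf : ∀ μ, fderiv ℝ f Z (EuclideanSpace.single μ 1) = ((c * u μ : ℝ) : ℂ))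
    (hg : ∀ μ, fderiv ℝ g Z (EuclideanSpace.single μ 1) = ((c * w μ : ℝ) : ℂ)) :
    poisson Θ f g Z = ((c ^ 2 * (u ⬝ᵥ Θ *ᵥ w) : ℝ) : ℂ) := by
  simp only [poisson, hf, hg, dotProduct, mulVec, Finset.mul_sum, Complex.ofReal_sum]
  refine Finset.sum_congr rfl fun μ _ => Finset.sum_congr rfl fun ν _ => ?_
  push_cast
  ring

open Matrix in
theorem dotProduct_mulVec_of_skew {n : Type*} [Fintype n] {Θ : Matrix n n ℝ} (hΘ : Θᵀ = -Θ)
    (u w : n → ℝ) : w ⬝ᵥ Θ *ᵥ u = -(u ⬝ᵥ Θ *ᵥ w) := by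
  rw [dotProduct_mulVec, ← mulVec_transpose, hΘ, neg_mulVec, neg_dotProduct, dotProduct_comm]

open Matrix in
theorem covector_dotProduct (Θ : Matrix (Fin (d + 1)) (Fin (d + 1)) ℝ) (b : Fin d) :
    covector H t x ⬝ᵥ Θ *ᵥ Pi.single b.succ 1 = bracket H t x Θ b := by
  rw [mulVec_single_one, covector, sub_dotProduct, single_one_dotProduct, bracket]
  simp [dotProduct, mul_comm]

theorem exp_neg_sq (H t : ℝ) : Real.exp (-(H * t)) ^ 2 = Real.exp (-2 * H * t) := by
  rw [← Real.exp_nat_mul]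
  congr 1
  push_cast
  ring

theorem CommutatorExpansion.congr {f g : Emb d → ℂ} {Z : Emb d}
    {L L' : Matrix (Fin (d + 1)) (Fin (d + 1)) ℝ → ℂ} (h : CommutatorExpansion f g Z L)
    (hL : ∀ Θ, Θ.transpose = -Θ → L Θ = L' Θ) : CommutatorExpansion f g Z L' := by
  obtain ⟨C, hC⟩ := h
  exact ⟨C, fun Θ hΘ => by simpa only [hL Θ hΘ] using hC Θ hΘ⟩

theorem commutatorExpansion_coordT_coordX (hH : 0 < H) (hpos : 0 < embLast H t x) {b : Fin d}
    {f g : Emb d → ℂ} (hf : Represents H t x coordT f) (hg : Represents H t x (coordX b) g) :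
    CommutatorExpansion f g (embPoint H t x) (fun Θ => leadTX H t x Θ b) := by
  refine (hf.1.commutatorExpansion hg.1 _).congr fun Θ hΘ => ?_
  rw [poisson_of_real (fderiv_of_represents_coordT hH hpos hf)
    (fderiv_of_represents_coordX hH hpos hg), leadTX, exp_neg_sq, Matrix.mulVec_sub,
    dotProduct_sub, covector_dotProduct, Matrix.mulVec_smul, dotProduct_smul]
  -- Skew-symmetry makes the pairing of the covector with itself its own negative, hence zero.
  have h0 := dotProduct_mulVec_of_skew hΘ (covector H t x) (covector H t x)
  rw [show covector H t x ⬝ᵥ Θ.mulVec (covector H t x) = 0 by linarith, smul_zero, sub_zero]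

theorem commutatorExpansion_coordX_coordX (hH : 0 < H) (hpos : 0 < embLast H t x) {a b : Fin d}
    {f g : Emb d → ℂ} (hf : Represents H t x (coordX a) f)
    (hg : Represents H t x (coordX b) g) :
    CommutatorExpansion f g (embPoint H t x) (fun Θ => leadXX H t x Θ a b) := by
  refine (hf.1.commutatorExpansion hg.1 _).congr fun Θ hΘ => ?_
  rw [poisson_of_real (fderiv_of_represents_coordX hH hpos hf)
    (fderiv_of_represents_coordX hH hpos hg), leadXX, exp_neg_sq]
  have h0 := dotProduct_mulVec_of_skew hΘ (covector H t x) (covector H t x)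
  have h1 := dotProduct_mulVec_of_skew hΘ (covector H t x) (Pi.single a.succ 1)
  have h2 : (Pi.single a.succ 1 : Fin (d + 1) → ℝ) ⬝ᵥ Θ.mulVec (Pi.single b.succ 1) =
      Θ a.succ b.succ := by
    rw [Matrix.mulVec_single_one, single_one_dotProduct, Matrix.col_apply]
  rw [covector_dotProduct] at h1
  rw [Matrix.mulVec_sub, dotProduct_sub, sub_dotProduct, sub_dotProduct, h2, smul_dotProduct,
    covector_dotProduct, Matrix.mulVec_smul, dotProduct_smul, dotProduct_smul, h1,
    smul_dotProduct, show covector H t x ⬝ᵥ Θ.mulVec (covector H t x) = 0 by linarith]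
  simp only [smul_eq_mul, mul_zero, sub_zero]
  congr 3
  ring

end Representatives

/-! ### Explicit form of F and exponential decay -/

section Decay

variable {d : ℕ} {H : ℝ}

theorem Fvec_zero (hH : 0 < H) (t : ℝ) (x : Fin d → ℝ) :
    Fvec H t x 0 = (Real.cosh (H * t) - H ^ 2 / 2 * Real.exp (H * t) * sqSum x)⁻¹ *
      (Real.sinh (H * t) + H ^ 2 / 2 * Real.exp (H * t) * sqSum x) := by
  have h : embLast H t x =
      H⁻¹ * (Real.cosh (H * t) - H ^ 2 / 2 * Real.exp (H * t) * sqSum x) := by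
    rw [embLast]
    field_simp
  simp only [Fvec, embPoint, Fin.cons_zero, h]
  rw [div_eq_mul_inv, mul_inv, inv_inv]
  field_simp

theorem Fvec_succ (hH : 0 < H) (t : ℝ) (x : Fin d → ℝ) (a : Fin d) :
    Fvec H t x a.succ = (Real.cosh (H * t) - H ^ 2 / 2 * Real.exp (H * t) * sqSum x)⁻¹ *
      (H * Real.exp (H * t) * x a) := by
  have h : embLast H t x =
      H⁻¹ * (Real.cosh (H * t) - H ^ 2 / 2 * Real.exp (H * t) * sqSum x) := by
    rw [embLast]
    field_simp
  simp only [Fvec, embPoint, Fin.cons_succ, h]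
  rw [div_eq_mul_inv, mul_inv, inv_inv]
  ring

theorem embLast_eq (hH : 0 < H) (t : ℝ) (x : Fin d → ℝ) :
    embLast H t x = (2 * H)⁻¹ * (Real.exp (H * t) * (1 - H ^ 2 * sqSum x) +
      Real.exp (-(H * t))) := by
  rw [embLast, Real.cosh_eq]
  field_simp
  ring

theorem sqSum_nonneg (x : Fin d → ℝ) : 0 ≤ sqSum x := Finset.sum_nonneg fun _ _ => sq_nonneg _

variable {x : Fin d → ℝ}

theorem embLast_pos (hH : 0 < H) (hx : H ^ 2 * sqSum x < 1) (t : ℝ) : 0 < embLast H t x := by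
  have : 0 < 1 - H ^ 2 * sqSum x := by linarith
  rw [embLast_eq hH]
  positivity

theorem abs_mul_le_one (hx : H ^ 2 * sqSum x < 1) (a : Fin d) : |H * x a| ≤ 1 := by
  have h : x a ^ 2 ≤ sqSum x :=
    Finset.single_le_sum (f := fun a => x a ^ 2) (fun _ _ => sq_nonneg _) (Finset.mem_univ a)
  rw [← sq_le_one_iff_abs_le_one, mul_pow]
  nlinarith [sq_nonneg H]

theorem abs_lowerIndex_Fvec_le (hH : 0 < H) (hx : H ^ 2 * sqSum x < 1) (t : ℝ)
    (μ : Fin (d + 1)) : |lowerIndex (Fvec H t x) μ| ≤ 2 / (1 - H ^ 2 * sqSum x) := by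
  have hδ : 0 < 1 - H ^ 2 * sqSum x := by linarith
  have hs : 0 ≤ H ^ 2 * sqSum x := mul_nonneg (sq_nonneg H) (sqSum_nonneg x)
  have hE := Real.exp_pos (H * t)
  have hE' := Real.exp_pos (-(H * t))
  have hl : |lowerIndex (Fvec H t x) μ| = |Fvec H t x μ| := by
    by_cases h : μ = 0 <;> simp [lowerIndex, h]
  have hD : Real.cosh (H * t) - H ^ 2 / 2 * Real.exp (H * t) * sqSum x =
      (Real.exp (H * t) * (1 - H ^ 2 * sqSum x) + Real.exp (-(H * t))) / 2 := by
    rw [Real.cosh_eq]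
    ring
  have hDpos : 0 < (Real.exp (H * t) * (1 - H ^ 2 * sqSum x) + Real.exp (-(H * t))) / 2 := by
    positivity
  -- With s = H²|x|² ≥ 0 one has (1 - s)(e^{Ht} + e^{-Ht}) ≤ (1 - s)e^{Ht} + e^{-Ht}, which bounds
  -- the quotient uniformly in t.
  have key : ∀ w : ℝ, |w| ≤ Real.exp (H * t) + Real.exp (-(H * t)) →
      |((Real.exp (H * t) * (1 - H ^ 2 * sqSum x) + Real.exp (-(H * t))) / 2)⁻¹ * w| ≤
        2 / (1 - H ^ 2 * sqSum x) := by
    intro w hw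
    rw [abs_mul, abs_of_pos (inv_pos.mpr hDpos), inv_mul_le_iff₀ hDpos]
    refine hw.trans ?_
    rw [mul_div_assoc', le_div_iff₀ hδ]
    nlinarith
  rw [hl]
  refine Fin.cases ?_ (fun a => ?_) μ
  · rw [Fvec_zero hH, hD]
    refine key _ ?_
    rw [Real.sinh_eq, abs_le]
    constructor <;> nlinarith
  · rw [Fvec_succ hH, hD]
    refine key _ ?_
    rw [show H * Real.exp (H * t) * x a = Real.exp (H * t) * (H * x a) by ring, abs_mul,
      abs_of_pos hE]
    have := abs_mul_le_one hx a
    nlinarith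

theorem abs_bracket_le (hH : 0 < H) (hx : H ^ 2 * sqSum x < 1) (t : ℝ) {r : ℝ}
    {Θ : Matrix (Fin (d + 1)) (Fin (d + 1)) ℝ} (hr : ∀ μ ν, |Θ μ ν| ≤ r) (b : Fin d) :
    |bracket H t x Θ b| ≤ (1 + (d + 1) * (2 / (1 - H ^ 2 * sqSum x))) * r := by
  have hr0 : 0 ≤ r := (abs_nonneg _).trans (hr 0 0)
  have h : |∑ ρ, Θ ρ b.succ * lowerIndex (Fvec H t x) ρ| ≤
      ∑ _ρ : Fin (d + 1), r * (2 / (1 - H ^ 2 * sqSum x)) := by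
    refine (Finset.abs_sum_le_sum_abs _ _).trans (Finset.sum_le_sum fun ρ _ => ?_)
    rw [abs_mul]
    exact mul_le_mul (hr _ _) (abs_lowerIndex_Fvec_le hH hx t ρ) (abs_nonneg _) hr0
  refine (abs_sub _ _).trans ((add_le_add (hr 0 b.succ) h).trans (le_of_eq ?_))
  simp
  ring

theorem exists_bound_lead (hH : 0 < H) (hx : H ^ 2 * sqSum x < 1) :
    ∃ K : ℝ, ∀ (t r : ℝ) (Θ : Matrix (Fin (d + 1)) (Fin (d + 1)) ℝ), (∀ μ ν, |Θ μ ν| ≤ r) →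
      (∀ b, ‖leadTX H t x Θ b‖ ≤ K * Real.exp (-2 * H * t) * r) ∧
      ∀ a b, ‖leadXX H t x Θ a b‖ ≤ K * Real.exp (-2 * H * t) * r := by
  have hδ : 0 < 1 - H ^ 2 * sqSum x := by linarith
  set M := 1 + (d + 1) * (2 / (1 - H ^ 2 * sqSum x))
  have hM0 : 0 ≤ M := by positivity
  -- The outer 2 is |2i|; inside, 1 accounts for Θ^{ab} and 2M for the two brackets, whose
  -- coefficients H x^a and H x^b are at most 1 in absolute value.
  refine ⟨2 * (1 + 2 * M), fun t r Θ hr => ?_⟩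
  have hr0 : 0 ≤ r := (abs_nonneg _).trans (hr 0 0)
  have hb := fun b => abs_bracket_le hH hx t hr b
  have hE := Real.exp_pos (-2 * H * t)
  have key : ∀ w : ℝ, |w| ≤ (1 + 2 * M) * r →
      ‖2 * Complex.I * ((Real.exp (-2 * H * t) * w : ℝ) : ℂ)‖ ≤
        2 * (1 + 2 * M) * Real.exp (-2 * H * t) * r := by
    intro w hw
    rw [norm_mul, norm_mul, Complex.norm_I, Complex.norm_real, Real.norm_eq_abs, abs_mul,
      abs_of_pos hE, Complex.norm_ofNat]
    calc 2 * 1 * (Real.exp (-2 * H * t) * |w|)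
        ≤ 2 * 1 * (Real.exp (-2 * H * t) * ((1 + 2 * M) * r)) := by gcongr
      _ = _ := by ring
  refine ⟨fun b => key _ ((hb b).trans (by nlinarith)), fun a b => key _ ?_⟩
  have h1 : |H * x a * bracket H t x Θ b| ≤ M * r := by
    rw [abs_mul]
    exact (mul_le_of_le_one_left (abs_nonneg _) (abs_mul_le_one hx a)).trans (hb b)
  have h2 : |H * x b * bracket H t x Θ a| ≤ M * r := by
    rw [abs_mul]
    exact (mul_le_of_le_one_left (abs_nonneg _) (abs_mul_le_one hx b)).trans (hb a)
  have h3 := hr a.succ b.succ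
  rw [abs_le] at *
  constructor <;> linarith [h1.1, h1.2, h2.1, h2.2, h3.1, h3.2]

end Decay

end DeSitter

theorem theorem1 (d : ℕ) (H : ℝ) (hH : 0 < H) :
    -- the commutation relations, at every point of the patch with `X^n > 0`
    (∀ (t : ℝ) (x : Fin d → ℝ), 0 < DeSitter.embLast H t x →
      -- the coordinates have admissible representatives at the point
      (∃ f, DeSitter.Represents H t x DeSitter.coordT f) ∧
      (∀ b, ∃ f, DeSitter.Represents H t x (DeSitter.coordX b) f) ∧
      -- `[t, x^b]_Θ`
      (∀ b f g, DeSitter.Represents H t x DeSitter.coordT f →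
        DeSitter.Represents H t x (DeSitter.coordX b) g →
        DeSitter.CommutatorExpansion f g (DeSitter.embPoint H t x)
          (fun Θ => DeSitter.leadTX H t x Θ b)) ∧
      -- `[x^a, x^b]_Θ`
      (∀ a b f g, DeSitter.Represents H t x (DeSitter.coordX a) f →
        DeSitter.Represents H t x (DeSitter.coordX b) g →
        DeSitter.CommutatorExpansion f g (DeSitter.embPoint H t x)
          (fun Θ => DeSitter.leadXX H t x Θ a b)) ∧
      -- the explicit form of `F`
      DeSitter.Fvec H t x 0 =
        (Real.cosh (H * t) - H ^ 2 / 2 * Real.exp (H * t) * DeSitter.sqSum x)⁻¹ *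
          (Real.sinh (H * t) + H ^ 2 / 2 * Real.exp (H * t) * DeSitter.sqSum x) ∧
      ∀ a : Fin d, DeSitter.Fvec H t x a.succ =
        (Real.cosh (H * t) - H ^ 2 / 2 * Real.exp (H * t) * DeSitter.sqSum x)⁻¹ *
          (H * Real.exp (H * t) * x a)) ∧
    -- exponential decay in `t` of the first-order terms, for `|x| < 1 / H`
    (∀ x : Fin d → ℝ, H ^ 2 * DeSitter.sqSum x < 1 →
      (∀ t : ℝ, 0 < DeSitter.embLast H t x) ∧
      ∃ K : ℝ, ∀ (t r : ℝ) (Θ : Matrix (Fin (d + 1)) (Fin (d + 1)) ℝ),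
        (∀ μ ν, |Θ μ ν| ≤ r) →
        (∀ b, ‖DeSitter.leadTX H t x Θ b‖ ≤ K * Real.exp (-2 * H * t) * r) ∧
        ∀ a b, ‖DeSitter.leadXX H t x Θ a b‖ ≤ K * Real.exp (-2 * H * t) * r) := by
  refine ⟨fun t x hpos => ⟨DeSitter.exists_represents_coordT hH hpos,
    DeSitter.exists_represents_coordX hH hpos,
    fun b f g hf hg => DeSitter.commutatorExpansion_coordT_coordX hH hpos hf hg,
    fun a b f g hf hg => DeSitter.commutatorExpansion_coordX_coordX hH hpos hf hg,
    DeSitter.Fvec_zero hH t x, DeSitter.Fvec_succ hH t x⟩,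
    fun x hx => ⟨DeSitter.embLast_pos hH hx, DeSitter.exists_bound_lead hH hx⟩⟩
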